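/- Setting. Fix a norm $\|\cdot\|$ on $\mathbb{R}^d$ with dual norm $\|g\|_*=\sup_{\|w\|\le 1}\langle g,w\rangle$. Let $\mathcal{X}\subseteq\mathbb{R}^d$ be non-empty, closed and convex, let $f:\mathcal{X}\to\mathbb{R}$ be convex and attain its minimum $f^*$ over $\mathcal X$ at $x^*\in\mathcal{X}$, and let $\partial f(x)=\{g:\ f(y)\ge f(x)+\langle g,y-x\rangle\ \forall y\in\mathcal{X}\}$. Let $\psi:\mathbb{R}^d\to(-\infty,+\infty]$ be a closed convex function, differentiable on $\operatorname{int}(\operatorname{dom}\psi)\neq\emptyset$, $1$-strongly convex with respect to $\|\cdot\|$ (that is, $\psi(x)\ge\psi(y)+\langle x-y,g\rangle+\frac12\|x-y\|^2$ for all $x,y\in\operatorname{dom}\psi$ and $g\in\partial\psi(y)$), with $\mathcal{X}\subseteq\operatorname{dom}\psi$, and such that either $\mathcal{X}\subseteq\operatorname{int}(\operatorname{dom}\psi)$, or $\|\nabla\psi(y_n)\|\to\infty$ for every sequence $(y_n)$ in $\operatorname{int}(\operatorname{dom}\psi)$ that converges to a boundary point of $\operatorname{dom}\psi$. Let $B_\psi(x,y)=\psi(x)-\psi(y)-\langle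 x-y,\nabla\psi(y)\rangle$. Stochastic mirror descent with step sizes $\eta_t>0$ starts at a deterministic $x_1\in\mathcal{X}\cap\operatorname{int}(\operatorname{dom}\psi)$ and, for $t=1,2,\dots$, receives $\hat g_t=g_t-\xi_t$ with $g_t\in\partial f(x_t)$ and chooses $$x_{t+1}\in\operatorname*{arg\,min}_{x\in\mathcal{X}}\ \langle\hat g_t,x\rangle+\tfrac1{\eta_t}B_\psi(x,x_t).$$ Let $\mathcal{F}_t=\sigma(\xi_1,\dots,\xi_t)$. Assume that each $g_t$ is $\mathcal{F}_{t-1}$-measurable, that $\|g_t\|_*\le G$ for all $t$ for a constant $G>0$, that $\mathbb{E}[\xi_t\mid\mathcal{F}_{t-1}]=0$, and that, for some $\theta\ge1$ and $\phi>0$, $\mathbb{E}\big[\exp\big((\|\xi_t\|_*/\phi)^{1/\theta}\big)\,\big|\,\mathcal{F}_{t-1}\big]\le2$ for all $t\ge1$. Put $\bar x_T=\frac1T\sum_{t=1}^Tx_t$. Claim. For every $\theta\ge1$ there is a constant $C>0$, depending only on $\theta$, such that in every such setting, for all $\delta\in(0,1)$, $\eta>0$ and $T\ge1$, the following holds with probability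 at least $1-\delta$. (i) If $\eta_t=\eta$ for all $t$, then $$f(\bar x_T)-f^*\le\frac{C}{T}\Big(\frac{B_\psi(x^*,x_1)}{\eta}+\eta\big(G^2+\phi^2\log(e/\delta)\big)T+\eta\phi^2\log^{2\theta}(eT/\delta)\Big).$$ (ii) If $\eta_t=\eta/\sqrt t$ for all $t$, then $$f(\bar x_T)-f^*\le\frac{C\log(eT)}{\sqrt T}\Big(\frac{B_\psi(x^*,x_1)}{\eta}+\eta\big(G^2+\phi^2\log^{2\theta}(e/\delta)\big)\Big).$$ -/

import Mathlib

open MeasureTheory Filter Topology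

namespace SMD

/- Throughout, `E` is a finite-dimensional real normed space, that is, `ℝ^d` with an arbitrary fixed
norm. Gradients and noise vectors live in its dual `StrongDual ℝ E`, whose operator norm is the dual
norm `‖g‖_* = sup_{‖w‖ ≤ 1} ⟨g, w⟩`, and `g w` is the pairing `⟨g, w⟩`. -/

section Deterministic

variable {E : Type*} [NormedAddCommGroup E] [NormedSpace ℝ E]

/-- The subdifferential at `y` of the function `h : D → ℝ` (values of `h` outside `D` are ignored,
as if they were `+∞`). -/
def subdifferential (D : Set E) (h : E → ℝ) (y : E) : Set (StrongDual ℝ E) :=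
  {g | ∀ x ∈ D, h y + g (x - y) ≤ h x}

/-- The effective domain `{x | ψ x < +∞}`. -/
def effDomain (ψ : E → EReal) : Set E := {x | ψ x < ⊤}

/-- The real value of an extended-real-valued function (meaningful on its effective domain). -/
noncomputable def realVal (ψ : E → EReal) (x : E) : ℝ := (ψ x).toReal

/-- The gradient of `ψ` at `y`, as an element of the dual space. -/
noncomputable def grad (ψ : E → EReal) (y : E) : StrongDual ℝ E := fderiv ℝ (realVal ψ) y

/-- The Bregman divergence `ψ x - ψ y - ⟨x - y, ∇ψ y⟩`. -/
noncomputable def bregman (ψ : E → EReal) (x y : E) : ℝ :=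
  realVal ψ x - realVal ψ y - grad ψ y (x - y)

/-- `ψ : E → (-∞, +∞]` is an admissible regularizer for the constraint set `X`. -/
structure IsRegularizer (X : Set E) (ψ : E → EReal) : Prop where
  ne_bot : ∀ x, ψ x ≠ ⊥
  convex : ConvexOn ℝ (effDomain ψ) (realVal ψ)
  closed : LowerSemicontinuous ψ
  differentiable : ∀ y ∈ interior (effDomain ψ), DifferentiableAt ℝ (realVal ψ) y
  /-- `1`-strong convexity with respect to the norm of `E`. -/
  strong_convex : ∀ x ∈ effDomain ψ, ∀ y ∈ effDomain ψ,
    ∀ g ∈ subdifferential (effDomain ψ) (realVal ψ) y,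
      realVal ψ y + g (x - y) + 1 / 2 * ‖x - y‖ ^ 2 ≤ realVal ψ x
  subset_domain : X ⊆ effDomain ψ
  interior_nonempty : (interior (effDomain ψ)).Nonempty
  barrier_or_interior :
    (∀ (y : ℕ → E) (z : E), (∀ n, y n ∈ interior (effDomain ψ)) → z ∈ frontier (effDomain ψ) →
      Tendsto y atTop (𝓝 z) → Tendsto (fun n => ‖grad ψ (y n)‖) atTop atTop) ∨
    X ⊆ interior (effDomain ψ)

end Deterministic

section Stochastic

variable {E Ω : Type*} [NormedAddCommGroup E] [NormedSpace ℝ E]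

/-- The sigma-algebra generated by the noise vectors `ξ 1, …, ξ n`. -/
@[reducible] noncomputable def noiseSigma (ξ : ℕ → Ω → StrongDual ℝ E) (n : ℕ) : MeasurableSpace Ω :=
  ⨆ s ∈ Set.Icc 1 n, MeasurableSpace.comap (ξ s) inferInstance

/-- Noise vectors `ξ 1, ξ 2, …` with conditional mean zero given the past noise. -/
structure IsCenteredNoise [MeasurableSpace Ω] (μ : Measure Ω) (ξ : ℕ → Ω → StrongDual ℝ E) :
    Prop where
  measurable : ∀ t ≥ 1, Measurable (ξ t)
  integrable : ∀ t ≥ 1, Integrable (ξ t) μ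
  condExp_eq_zero : ∀ t ≥ 1, μ[ξ t | noiseSigma ξ (t - 1)] =ᵐ[μ] 0

/-- The dual norm of each noise vector is sub-Weibull`(θ, φ)` conditionally on the past noise. The
integrability requirement only excludes the junk value of the conditional expectation. -/
def IsCondSubWeibull [MeasurableSpace Ω] (μ : Measure Ω) (ξ : ℕ → Ω → StrongDual ℝ E)
    (θ φ : ℝ) : Prop :=
  ∀ t ≥ 1, Integrable (fun ω => Real.exp ((‖ξ t ω‖ / φ) ^ (1 / θ))) μ ∧
    μ[fun ω => Real.exp ((‖ξ t ω‖ / φ) ^ (1 / θ)) | noiseSigma ξ (t - 1)] ≤ᵐ[μ] fun _ => 2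

/-- A run of stochastic mirror descent on `f : X → ℝ` with regularizer `ψ`, step sizes `η t`, first
point `x₁`, iterates `x t`, subgradients `g t` and noise `ξ t`; at step `t ≥ 1` the learner sees only
`g t - ξ t`. The subgradient `g t` is determined by what happened before step `t`. -/
structure IsSMDRun (X : Set E) (f : E → ℝ) (ψ : E → EReal) (η : ℕ → ℝ) (x₁ : E)
    (x : ℕ → Ω → E) (g ξ : ℕ → Ω → StrongDual ℝ E) : Prop where
  init_mem : x₁ ∈ X
  init_mem_interior : x₁ ∈ interior (effDomain ψ)
  init_eq : ∀ ω, x 1 ω = x₁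
  subgradient : ∀ t ≥ 1, ∀ ω, g t ω ∈ subdifferential X f (x t ω)
  predictable : ∀ t ≥ 1, Measurable[noiseSigma ξ (t - 1)] (g t)
  step_mem : ∀ t ≥ 1, ∀ ω, x (t + 1) ω ∈ X
  step_min : ∀ t ≥ 1, ∀ ω,
    IsMinOn (fun u => (g t ω - ξ t ω) u + 1 / η t * bregman ψ u (x t ω)) X (x (t + 1) ω)

/-- The average iterate `(1/T) ∑_{t=1}^T x t`. -/
noncomputable def avgIterate (x : ℕ → Ω → E) (T : ℕ) (ω : Ω) : E :=
  (1 / (T : ℝ)) • ∑ t ∈ Finset.Icc 1 T, x t ω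

/-- `P` holds with probability at least `p`: it holds on some event of probability at least `p`
(for a measurable `P` this is just `p ≤ μ {ω | P ω}`). -/
def HoldsWithProb [MeasurableSpace Ω] (μ : Measure Ω) (p : ℝ) (P : Ω → Prop) : Prop :=
  ∃ A, MeasurableSet A ∧ ENNReal.ofReal p ≤ μ A ∧ ∀ ω ∈ A, P ω

end Stochastic

end SMD

/-!
Let `l = log (e / δ)`. The one-step inequality of mirror descent, summed over time, bounds the
weighted regret plus `bregman ψ xstar (x (n + 1))` by `bregman ψ xstar x₁`, a multiple of
`∑ η t ^ 2`, and the noise `∑ (η t * ξ t (x t - xstar) + η t ^ 2 * ‖ξ t‖ ^ 2)`. The domain may be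
unbounded, so the martingale part has no a priori bound. Instead one fixes a radius `R` and sets the
displacement `x t - xstar` to zero as soon as an iterate leaves the ball of radius `R` around
`xstar`. If this *confined* noise is small compared to `R ^ 2`, then strong convexity of `ψ` shows
that the iterates never leave the ball, so that nothing was changed and the regret is at most
`R ^ 2 / 2` (`SMD.IsSMDRun.sum_regret_le_of_confined`). Only the noise at the final time has to be
controlled; no maximal inequality is needed.

The confined noise is handled by a Chernoff bound with parameter `s = 4 * l / R ^ 2`
(`SMD.holdsWithProb_confined_noise`). The exponential moments of sub-Weibull variables with `θ > 1`
may be infinite, so the noise at time `t` is truncated at `‖ξ t‖ ≤ φ * a t ^ θ`, where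
`a t = log (8 * t ^ 2 / δ)`; this fails for some `t` with probability at most `δ / 2`. Below that
level `s` times an increment is at most half of `(‖ξ t‖ / φ) ^ (1 / θ)` once `R` exceeds a multiple
of `φ * η t * a t ^ θ` for all `t`, so the exponential of an increment is bounded, to second order,
by `1`, a predictable linear function of `ξ t`, and a multiple of
`exp ((‖ξ t‖ / φ) ^ (1 / θ))`. Above that level only the negative part of the linear term is kept,
which preserves this bound, so truncation creates no bias (`SMD.exp_truncated_le`). Conditional
expectations then give an exponential supermartingale (`SMD.integral_exp_sum_le`).

This needs the iterates to be predictable. They stay in the interior of the domain of `ψ`, by the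
barrier condition (`SMD.IsRegularizer.mem_interior_of_isMinOn`), and each is a Lipschitz function of
the dual vector `η t • (g t - ξ t) - ∇ψ (x t)`, by strong convexity
(`SMD.IsRegularizer.norm_sub_le_of_isMinOn`). Finally `R ^ 2` is evaluated for the two schedules:
for `η / √t` the factor `1 / t` in `η t ^ 2` absorbs the growth of `a t ^ (2 * θ)`, which is why the
second bound has `log (e / δ)` in place of `log (e * T / δ)`.
-/

/-! ### Bregman geometry of the regularizer -/

namespace SMD

section Geometry

variable {E : Type*} [NormedAddCommGroup E] [NormedSpace ℝ E] {X : Set E} {ψ : E → EReal}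

/-- First-order optimality over a convex set. -/
lemma fderiv_sub_nonneg_of_isMinOn {h : E → ℝ} {z u : E} (hX : Convex ℝ X) (hz : z ∈ X)
    (hu : u ∈ X) (hd : DifferentiableAt ℝ h z) (hmin : IsMinOn h X z) :
    0 ≤ fderiv ℝ h z (u - z) :=
  hmin.localize.hasFDerivWithinAt_nonneg hd.hasFDerivAt.hasFDerivWithinAt
    (sub_mem_posTangentConeAt_of_segment_subset (hX.segment_subset hz hu))

namespace IsRegularizer

lemma grad_mem_subdifferential (hψ : IsRegularizer X ψ) {y : E}
    (hy : y ∈ interior (effDomain ψ)) :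
    grad ψ y ∈ subdifferential (effDomain ψ) (realVal ψ) y := by
  intro x hx
  have hc := hψ.convex.comp_affineMap (AffineMap.lineMap y x : ℝ →ᵃ[ℝ] E)
  have hd : HasDerivAt (realVal ψ ∘ (AffineMap.lineMap y x : ℝ →ᵃ[ℝ] E)) (grad ψ y (x - y)) 0 := by
    have h1 : HasFDerivAt (realVal ψ) (grad ψ y) ((AffineMap.lineMap y x : ℝ →ᵃ[ℝ] E) 0) := by
      rw [AffineMap.lineMap_apply_zero]
      exact (hψ.differentiable y hy).hasFDerivAt
    exact h1.comp_hasDerivAt 0 AffineMap.hasDerivAt_lineMap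
  have := hc.le_slope_of_hasDerivAt (x := 0) (y := 1) (by simpa using interior_subset hy)
    (by simpa using hx) one_pos hd
  simp [slope] at this
  rw [map_sub]
  linarith

lemma half_sq_norm_le_bregman (hψ : IsRegularizer X ψ) {x y : E} (hx : x ∈ effDomain ψ)
    (hy : y ∈ interior (effDomain ψ)) : 1 / 2 * ‖x - y‖ ^ 2 ≤ bregman ψ x y := by
  have := hψ.strong_convex x hx y (interior_subset hy) _ (hψ.grad_mem_subdifferential hy)
  unfold bregman
  linarith

/-- The barrier property keeps minimizers of `ψ` plus a linear function away from the boundary of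
the domain of `ψ`. Along the segment from a boundary minimizer `z` to an interior point `x₁`, the
gradient of `ψ` cannot be very negative in the direction `x₁ - z`, by minimality of `z`; since `ψ`
is bounded near `x₁`, this bounds the norm of the gradient along the segment. -/
lemma mem_interior_of_isMinOn (hψ : IsRegularizer X ψ) (hX : Convex ℝ X) {x₁ z : E}
    (hx₁ : x₁ ∈ X) (hx₁i : x₁ ∈ interior (effDomain ψ)) (hz : z ∈ X) (v : StrongDual ℝ E)
    (hmin : IsMinOn (fun u => v u + realVal ψ u) X z) : z ∈ interior (effDomain ψ) := by
  rcases hψ.barrier_or_interior with hb | hi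
  swap
  · exact hi hz
  by_contra hzi
  have hzD : z ∈ effDomain ψ := hψ.subset_domain hz
  set s : ℕ → ℝ := fun n => 1 / ((n : ℝ) + 1) with hs
  have hs0 : ∀ n, 0 < s n := fun n => Nat.one_div_pos_of_nat
  have hs1 : ∀ n, s n ≤ 1 := fun n => by
    rw [hs]; simp only
    rw [div_le_one (by positivity)]
    linarith [(Nat.cast_nonneg n : (0 : ℝ) ≤ n)]
  set y : ℕ → E := fun n => z + s n • (x₁ - z) with hy
  have hyi : ∀ n, y n ∈ interior (effDomain ψ) := fun n =>
    hψ.convex.1.add_smul_sub_mem_interior hzD hx₁i ⟨hs0 n, hs1 n⟩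
  have hyX : ∀ n, y n ∈ X := fun n =>
    hX.add_smul_sub_mem hz hx₁ ⟨(hs0 n).le, hs1 n⟩
  have hlim : Tendsto y atTop (𝓝 z) := by
    have h1 : Tendsto s atTop (𝓝 0) := tendsto_one_div_add_atTop_nhds_zero_nat
    simpa using (h1.smul_const (x₁ - z)).const_add z
  have htop := hb y z hyi ⟨subset_closure hzD, hzi⟩ hlim
  obtain ⟨r, hr, hball⟩ : ∃ r > 0, ∀ u ∈ Metric.closedBall x₁ r,
      u ∈ effDomain ψ ∧ realVal ψ u < realVal ψ x₁ + 1 := by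
    have h1 : ∀ᶠ u in 𝓝 x₁, u ∈ effDomain ψ ∧ realVal ψ u < realVal ψ x₁ + 1 :=
      (show ∀ᶠ u in 𝓝 x₁, u ∈ effDomain ψ from mem_interior_iff_mem_nhds.1 hx₁i).and
        ((hψ.differentiable x₁ hx₁i).continuousAt.eventually_lt_const (lt_add_one _))
    exact (Metric.nhds_basis_closedBall.eventually_iff.1 h1)
  set K : ℝ := realVal ψ x₁ + 1 - realVal ψ z + 2 * (‖v‖ * ‖x₁ - z‖) with hK
  have hbound : ∀ n, ‖grad ψ (y n)‖ ≤ K / r := by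
    intro n
    set p := grad ψ (y n) with hp
    have hsub := hψ.grad_mem_subdifferential (hyi n)
    have hv : |v (x₁ - z)| ≤ ‖v‖ * ‖x₁ - z‖ := v.le_opNorm _
    have hmn : v z + realVal ψ z ≤ v (y n) + realVal ψ (y n) := hmin (hyX n)
    have hyz : v (y n) = v z + s n * v (x₁ - z) := by simp [hy]
    have hsv : |s n * v (x₁ - z)| ≤ ‖v‖ * ‖x₁ - z‖ := by
      rw [abs_mul, abs_of_pos (hs0 n)]
      exact (mul_le_of_le_one_left (abs_nonneg _) (hs1 n)).trans hv
    have h2 := hsub z hzD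
    have hzy : z - y n = -(s n • (x₁ - z)) := by simp [hy]
    rw [hzy, map_neg, map_smul, smul_eq_mul] at h2
    have h3 : -v (x₁ - z) ≤ p (x₁ - z) := by
      have : s n * (-v (x₁ - z)) ≤ s n * p (x₁ - z) := by linarith
      exact le_of_mul_le_mul_left this (hs0 n)
    have hxy : x₁ - y n = (1 - s n) • (x₁ - z) := by
      simp only [hy, sub_smul, one_smul]; abel
    have h4 : -((1 - s n) * v (x₁ - z)) ≤ p (x₁ - y n) := by
      rw [hxy, map_smul, smul_eq_mul]
      have := mul_le_mul_of_nonneg_left h3 (sub_nonneg.2 (hs1 n))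
      linarith
    have hsv' : (1 - s n) * v (x₁ - z) ≤ ‖v‖ * ‖x₁ - z‖ := by
      refine (le_abs_self _).trans ?_
      rw [abs_mul, abs_of_nonneg (sub_nonneg.2 (hs1 n))]
      exact (mul_le_of_le_one_left (abs_nonneg _) (by linarith [hs0 n])).trans hv
    have key : ∀ w : E, ‖w‖ ≤ r → p w ≤ K := by
      intro w hw
      obtain ⟨hD, hlt⟩ := hball (x₁ + w) (by simpa using hw)
      have h5 := hsub _ hD
      have : x₁ + w - y n = (x₁ - y n) + w := by abel
      rw [this, map_add] at h5
      have := abs_le.1 hsv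
      linarith [this.1, this.2]
    refine ContinuousLinearMap.opNorm_bound_of_ball_bound hr K p fun w hw => ?_
    have hw' : ‖w‖ ≤ r := by simpa using hw
    rw [Real.norm_eq_abs, abs_le]
    constructor
    · have := key (-w) (by simpa using hw')
      rw [map_neg] at this
      linarith
    · exact key w hw'
  obtain ⟨n, hn⟩ := (htop.eventually_gt_atTop (K / r)).exists
  exact absurd (hbound n) (not_le.2 hn)

/-- Minimizers of `ψ` plus a linear function depend on the linear function in a `1`-Lipschitz way,
by strong convexity. -/
lemma norm_sub_le_of_isMinOn (hψ : IsRegularizer X ψ) (hX : Convex ℝ X) {z z' : E} (hz : z ∈ X)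
    (hz' : z' ∈ X) (hzi : z ∈ interior (effDomain ψ)) (hzi' : z' ∈ interior (effDomain ψ))
    {v v' : StrongDual ℝ E} (hmin : IsMinOn (fun u => v u + realVal ψ u) X z)
    (hmin' : IsMinOn (fun u => v' u + realVal ψ u) X z') : ‖z - z'‖ ≤ ‖v - v'‖ := by
  have opt : ∀ {z : E} {v : StrongDual ℝ E}, z ∈ interior (effDomain ψ) → z ∈ X →
      IsMinOn (fun u => v u + realVal ψ u) X z → ∀ u ∈ X, 0 ≤ v (u - z) + grad ψ z (u - z) := by
    intro z v hzi hz hmin u hu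
    have hd := v.hasFDerivAt.add (hψ.differentiable z hzi).hasFDerivAt
    have := fderiv_sub_nonneg_of_isMinOn hX hz hu hd.differentiableAt hmin
    rwa [hd.fderiv] at this
  have h1 := opt hzi hz hmin z' hz'
  have h2 := opt hzi' hz' hmin' z hz
  have h3 := hψ.half_sq_norm_le_bregman (hψ.subset_domain hz) hzi'
  have h4 := hψ.half_sq_norm_le_bregman (hψ.subset_domain hz') hzi
  unfold bregman at h3 h4
  rw [norm_sub_rev z' z] at h4
  have h5 : (v - v') (z' - z) ≤ ‖v - v'‖ * ‖z - z'‖ := by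
    rw [norm_sub_rev z z']
    exact (le_abs_self _).trans ((v - v').le_opNorm _)
  have e1 : ∀ w : StrongDual ℝ E, w (z' - z) = -w (z - z') := fun w => by
    rw [← map_neg, neg_sub]
  rw [e1] at h1 h4 h5
  rw [e1 (grad ψ z)] at h1
  rw [sub_apply] at h5
  have h6 : ‖z - z'‖ * ‖z - z'‖ ≤ ‖v - v'‖ * ‖z - z'‖ := by nlinarith
  rcases (norm_nonneg (z - z')).eq_or_lt with h0 | h0
  · rw [← h0]; exact norm_nonneg _
  · exact le_of_mul_le_mul_right h6 h0

end IsRegularizer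

/-- The mirror-descent objective is, up to scaling and a constant, `ψ` plus a linear function. -/
lemma isMinOn_add_realVal_of_step {η : ℝ} (hη : 0 < η) {w : StrongDual ℝ E} {y z : E}
    (hmin : IsMinOn (fun u => w u + 1 / η * bregman ψ u y) X z) :
    IsMinOn (fun u => (η • w - grad ψ y) u + realVal ψ u) X z := by
  intro u hu
  have h : w z + 1 / η * bregman ψ z y ≤ w u + 1 / η * bregman ψ u y := hmin hu
  have h' := mul_le_mul_of_nonneg_left h hη.le
  have e : ∀ u, η * (w u + 1 / η * bregman ψ u y) = η * w u + bregman ψ u y := fun u => by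
    field_simp
  rw [e, e] at h'
  simp only [bregman, map_sub] at h'
  simp only [Set.mem_ofPred_eq, sub_apply, smul_apply,
    smul_eq_mul]
  linarith

/-- The one-step inequality of mirror descent. -/
lemma IsRegularizer.mirror_step (hψ : IsRegularizer X ψ) (hX : Convex ℝ X) {η : ℝ} (hη : 0 < η)
    {w : StrongDual ℝ E} {y z u : E} (hy : y ∈ interior (effDomain ψ)) (hz : z ∈ X)
    (hzi : z ∈ interior (effDomain ψ)) (hu : u ∈ X)
    (hmin : IsMinOn (fun u => w u + 1 / η * bregman ψ u y) X z) :
    η * w (y - u) ≤ bregman ψ u y - bregman ψ u z + η ^ 2 / 2 * ‖w‖ ^ 2 := by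
  have hd := (η • w - grad ψ y).hasFDerivAt.add (hψ.differentiable z hzi).hasFDerivAt
  have h1 := fderiv_sub_nonneg_of_isMinOn hX hz hu hd.differentiableAt
    (isMinOn_add_realVal_of_step hη hmin)
  rw [hd.fderiv] at h1
  have h2 := hψ.half_sq_norm_le_bregman (hψ.subset_domain hz) hy
  have h3 : w (y - z) ≤ ‖w‖ * ‖z - y‖ := by
    rw [norm_sub_rev]
    exact (le_abs_self _).trans (w.le_opNorm _)
  have h4 := mul_le_mul_of_nonneg_left h3 hη.le
  have h5 := sq_nonneg (η * ‖w‖ - ‖z - y‖)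
  change 0 ≤ (η * w (u - z) - grad ψ y (u - z)) + grad ψ z (u - z) at h1
  unfold bregman at h2 ⊢
  simp only [map_sub] at *
  nlinarith

end Geometry

end SMD

/-! ### Measurability of the iterates -/

namespace SMD

section Measurability

variable {E Ω : Type*} [NormedAddCommGroup E] [NormedSpace ℝ E]

lemma noiseSigma_mono (ξ : ℕ → Ω → StrongDual ℝ E) : Monotone (noiseSigma ξ) := fun _ _ h =>
  biSup_mono fun _ hs => ⟨hs.1, hs.2.trans h⟩

lemma measurable_noiseSigma (ξ : ℕ → Ω → StrongDual ℝ E) {t : ℕ} (ht : 1 ≤ t) :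
    Measurable[noiseSigma ξ t] (ξ t) :=
  measurable_iff_comap_le.2
    (le_biSup (fun s => MeasurableSpace.comap (ξ s) inferInstance) (⟨ht, le_rfl⟩ : t ∈ Set.Icc 1 t))

lemma noiseSigma_le [mΩ : MeasurableSpace Ω] {ξ : ℕ → Ω → StrongDual ℝ E}
    (hξ : ∀ t ≥ 1, Measurable (ξ t)) (n : ℕ) : noiseSigma ξ n ≤ mΩ :=
  iSup₂_le fun s hs => measurable_iff_comap_le.1 (hξ s hs.1)

/-- A map that varies no more than a measurable map is measurable: it is a Lipschitz function of
that map. -/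
lemma stronglyMeasurable_of_norm_sub_le [FiniteDimensional ℝ E] {V : Type*}
    [NormedAddCommGroup V] {m : MeasurableSpace Ω} {v : Ω → V} {x : Ω → E}
    (hv : StronglyMeasurable[m] v) (h : ∀ ω ω', ‖x ω - x ω'‖ ≤ ‖v ω - v ω'‖) :
    StronglyMeasurable[m] x := by
  rcases isEmpty_or_nonempty Ω with he | hne
  · exact stronglyMeasurable_const' fun ω => he.elim ω
  have hfac : ∀ ω, x (Function.invFun v (v ω)) = x ω := fun ω => by
    have h1 : v (Function.invFun v (v ω)) = v ω := Function.invFun_eq ⟨ω, rfl⟩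
    have h2 := h (Function.invFun v (v ω)) ω
    rw [h1, sub_self, norm_zero] at h2
    exact sub_eq_zero.1 (norm_eq_zero.1 (le_antisymm h2 (norm_nonneg _)))
  have hL : LipschitzOnWith 1 (fun p => x (Function.invFun v p)) (Set.range v) := by
    refine LipschitzOnWith.of_dist_le_mul ?_
    rintro _ ⟨ω, rfl⟩ _ ⟨ω', rfl⟩
    rw [hfac, hfac, dist_eq_norm, dist_eq_norm]
    simpa using h ω ω'
  obtain ⟨k, hk, hkeq⟩ := hL.extend_finite_dimension
  have : x = fun ω => k (v ω) := funext fun ω => by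
    rw [← hkeq ⟨ω, rfl⟩]
    exact (hfac ω).symm
  rw [this]
  exact hk.continuous.comp_stronglyMeasurable hv

namespace IsSMDRun

variable {X : Set E} {f : E → ℝ} {ψ : E → EReal} {η : ℕ → ℝ} {x₁ : E} {x : ℕ → Ω → E}
  {g ξ : ℕ → Ω → StrongDual ℝ E}

lemma mem (hrun : IsSMDRun X f ψ η x₁ x g ξ) {t : ℕ} (ht : 1 ≤ t) (ω : Ω) : x t ω ∈ X := by
  induction t, ht using Nat.le_induction with
  | base => rw [hrun.init_eq]; exact hrun.init_mem
  | succ t ht _ => exact hrun.step_mem t ht ω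

lemma mem_interior (hrun : IsSMDRun X f ψ η x₁ x g ξ) (hψ : IsRegularizer X ψ) (hX : Convex ℝ X)
    (hη : ∀ t ≥ 1, 0 < η t) {t : ℕ} (ht : 1 ≤ t) (ω : Ω) :
    x t ω ∈ interior (effDomain ψ) := by
  induction t, ht using Nat.le_induction with
  | base => rw [hrun.init_eq]; exact hrun.init_mem_interior
  | succ t ht _ =>
    exact hψ.mem_interior_of_isMinOn hX hrun.init_mem hrun.init_mem_interior
      (hrun.step_mem t ht ω) _ (isMinOn_add_realVal_of_step (hη t ht) (hrun.step_min t ht ω))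

lemma stronglyMeasurable_iterate [FiniteDimensional ℝ E] (hrun : IsSMDRun X f ψ η x₁ x g ξ)
    (hψ : IsRegularizer X ψ) (hX : Convex ℝ X) (hη : ∀ t ≥ 1, 0 < η t) {t : ℕ} (ht : 1 ≤ t) :
    StronglyMeasurable[noiseSigma ξ (t - 1)] (x t) := by
  induction t, ht using Nat.le_induction with
  | base =>
    rw [show x 1 = fun _ => x₁ from funext hrun.init_eq]
    exact stronglyMeasurable_const
  | succ t ht ih =>
    have hv : StronglyMeasurable[noiseSigma ξ t]
        (fun ω => η t • (g t ω - ξ t ω) - grad ψ (x t ω)) := by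
      borelize E
      have hle := noiseSigma_mono ξ (Nat.sub_le t 1)
      have hx : StronglyMeasurable[noiseSigma ξ t] (x t) := ih.mono hle
      have hg : Measurable[noiseSigma ξ t] (g t) := (hrun.predictable t ht).mono hle le_rfl
      have h1 : Measurable[noiseSigma ξ t] (fun ω => grad ψ (x t ω)) :=
        (measurable_fderiv ℝ (realVal ψ)).comp hx.measurable
      exact ((hg.stronglyMeasurable.sub (measurable_noiseSigma ξ ht).stronglyMeasurable).const_smul
        (η t)).sub h1.stronglyMeasurable
    rw [Nat.add_sub_cancel]
    refine stronglyMeasurable_of_norm_sub_le hv fun ω ω' => ?_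
    exact hψ.norm_sub_le_of_isMinOn hX (hrun.step_mem t ht ω) (hrun.step_mem t ht ω')
      (hrun.mem_interior hψ hX hη (by omega) ω) (hrun.mem_interior hψ hX hη (by omega) ω')
      (isMinOn_add_realVal_of_step (hη t ht) (hrun.step_min t ht ω))
      (isMinOn_add_realVal_of_step (hη t ht) (hrun.step_min t ht ω'))

end IsSMDRun

end Measurability

end SMD

/-! ### Exponential moments of the noise -/

namespace SMD

section Probability

variable {E Ω : Type*} [NormedAddCommGroup E] [NormedSpace ℝ E]

/-- One step of the exponential supermartingale: `Y` plays the role of the exponential of the new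
increment, `W` that of the exponential of the past. -/
lemma integral_mul_le_of_condExp {m mΩ : MeasurableSpace Ω} (hm : m ≤ mΩ) {μ : Measure Ω}
    [IsProbabilityMeasure μ] {Z : Ω → StrongDual ℝ E} (hZ : Integrable Z μ) (hZ0 : μ[Z | m] =ᵐ[μ] 0)
    {Q : Ω → ℝ} (hQ : Integrable Q μ) (hQ2 : μ[Q | m] ≤ᵐ[μ] fun _ => 2)
    {v : Ω → E} (hv : StronglyMeasurable[m] v) {b : ℝ} (hvb : ∀ ω, ‖v ω‖ ≤ b)
    {W : Ω → ℝ} (hW : StronglyMeasurable[m] W) (hW0 : ∀ ω, 0 ≤ W ω) {c : ℝ} (hWc : ∀ ω, W ω ≤ c)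
    {Y : Ω → ℝ} (hY : Integrable (fun ω => W ω * Y ω) μ) {κ : ℝ} (hκ : 0 ≤ κ)
    (hle : ∀ ω, Y ω ≤ 1 + Z ω (v ω) + κ * Q ω) :
    ∫ ω, W ω * Y ω ∂μ ≤ (1 + 2 * κ) * ∫ ω, W ω ∂μ := by
  have hWb : ∀ ω, ‖W ω‖ ≤ c := fun ω => by
    rw [Real.norm_eq_abs, abs_of_nonneg (hW0 ω)]; exact hWc ω
  have hWm : AEStronglyMeasurable W μ := (hW.mono hm).aestronglyMeasurable
  have hWi : Integrable W μ := Integrable.of_bound hWm c (ae_of_all _ hWb)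
  have hWv : StronglyMeasurable[m] (fun ω => W ω • v ω) := hW.smul hv
  have hWvb : ∀ ω, ‖W ω • v ω‖ ≤ c * b := fun ω => by
    rw [norm_smul]
    exact mul_le_mul (hWb ω) (hvb ω) (norm_nonneg _) ((norm_nonneg _).trans (hWb ω))
  have hZi : Integrable (fun ω => Z ω (W ω • v ω)) μ :=
    (ContinuousLinearMap.apply ℝ ℝ).integrable_of_bilin_of_bdd_left (c * b)
      (hWv.mono hm).aestronglyMeasurable (ae_of_all _ hWvb) hZ
  have hZint : ∫ ω, Z ω (W ω • v ω) ∂μ = 0 := by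
    have h1 := condExp_stronglyMeasurable_bilin_of_bound (ContinuousLinearMap.apply ℝ ℝ) hm hWv hZ
      (c * b) (ae_of_all μ hWvb)
    rw [← integral_condExp hm]
    refine integral_eq_zero_of_ae ?_
    filter_upwards [h1, hZ0] with ω h2 h3
    refine h2.trans ?_
    rw [h3]
    simp
  have hWQi : Integrable (fun ω => W ω * Q ω) μ := hQ.bdd_mul hWm (ae_of_all _ hWb)
  have hWQ : ∫ ω, W ω * Q ω ∂μ ≤ 2 * ∫ ω, W ω ∂μ := by
    have h1 : μ[fun ω => W ω * Q ω | m] =ᵐ[μ] fun ω => W ω * (μ[Q | m]) ω :=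
      condExp_mul_of_stronglyMeasurable_left hW hWQi hQ
    rw [← integral_condExp hm, ← integral_const_mul]
    refine integral_mono_ae integrable_condExp (hWi.const_mul 2) ?_
    filter_upwards [h1, hQ2] with ω h2 h3
    rw [h2]
    have := mul_le_mul_of_nonneg_left h3 (hW0 ω)
    simpa [mul_comm] using this
  calc ∫ ω, W ω * Y ω ∂μ
      ≤ ∫ ω, (W ω + Z ω (W ω • v ω) + κ * (W ω * Q ω)) ∂μ := by
        refine integral_mono hY ((hWi.add hZi).add (hWQi.const_mul κ)) fun ω => ?_
        have := mul_le_mul_of_nonneg_left (hle ω) (hW0 ω)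
        simp only [map_smul, smul_eq_mul]
        linarith
    _ = ∫ ω, W ω ∂μ + κ * ∫ ω, W ω * Q ω ∂μ := by
        have hWZ : Integrable (fun ω => W ω + Z ω (W ω • v ω)) μ := hWi.add hZi
        rw [integral_add hWZ (hWQi.const_mul κ), integral_add hWi hZi, hZint,
          integral_const_mul, add_zero]
    _ ≤ (1 + 2 * κ) * ∫ ω, W ω ∂μ := by
        have := mul_le_mul_of_nonneg_left hWQ hκ
        linarith

variable [MeasurableSpace Ω] {μ : Measure Ω} [IsProbabilityMeasure μ]
  {ξ : ℕ → Ω → StrongDual ℝ E} {θ φ : ℝ}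

/-- An exponential moment bound for sums of adapted increments `U t` whose exponentials are
dominated by `1`, a predictable linear function of the noise, and a multiple of the sub-Weibull
exponential. -/
lemma integral_exp_sum_le (hξ : IsCenteredNoise μ ξ) (hw : IsCondSubWeibull μ ξ θ φ)
    {v : ℕ → Ω → E} (hv : ∀ t ≥ 1, StronglyMeasurable[noiseSigma ξ (t - 1)] (v t))
    (hvb : ∀ t ≥ 1, ∃ b, ∀ ω, ‖v t ω‖ ≤ b)
    {U : ℕ → Ω → ℝ} (hU : ∀ t ≥ 1, Measurable[noiseSigma ξ t] (U t))
    (hUb : ∀ t ≥ 1, ∃ b, ∀ ω, U t ω ≤ b) {κ : ℕ → ℝ} (hκ : ∀ t, 0 ≤ κ t)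
    {n : ℕ} (hpt : ∀ t ∈ Finset.Icc 1 n, ∀ ω, Real.exp (U t ω) ≤
      1 + ξ t ω (v t ω) + κ t * Real.exp ((‖ξ t ω‖ / φ) ^ (1 / θ))) :
    Integrable (fun ω => Real.exp (∑ t ∈ Finset.Icc 1 n, U t ω)) μ ∧
    ∫ ω, Real.exp (∑ t ∈ Finset.Icc 1 n, U t ω) ∂μ ≤ Real.exp (2 * ∑ t ∈ Finset.Icc 1 n, κ t) := by
  have hmeas : ∀ n, Measurable[noiseSigma ξ n]
      (fun ω => Real.exp (∑ t ∈ Finset.Icc 1 n, U t ω)) := fun n =>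
    Real.measurable_exp.comp (Finset.measurable_fun_sum _ fun t ht =>
      (hU t (Finset.mem_Icc.1 ht).1).mono (noiseSigma_mono ξ (Finset.mem_Icc.1 ht).2) le_rfl)
  have hbdd : ∀ n, ∃ c, ∀ ω, Real.exp (∑ t ∈ Finset.Icc 1 n, U t ω) ≤ c := by
    intro n
    choose! b hb using hUb
    exact ⟨Real.exp (∑ t ∈ Finset.Icc 1 n, b t), fun ω => Real.exp_le_exp.2
      (Finset.sum_le_sum fun t ht => hb t (Finset.mem_Icc.1 ht).1 ω)⟩
  have hint : ∀ n, Integrable (fun ω => Real.exp (∑ t ∈ Finset.Icc 1 n, U t ω)) μ := by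
    intro n
    obtain ⟨c, hc⟩ := hbdd n
    refine Integrable.of_bound
      ((hmeas n).mono (noiseSigma_le hξ.measurable n) le_rfl).aestronglyMeasurable c
      (ae_of_all _ fun ω => ?_)
    rw [Real.norm_eq_abs, abs_of_pos (Real.exp_pos _)]
    exact hc ω
  refine ⟨hint n, ?_⟩
  induction n with
  | zero => simp
  | succ n ih =>
    specialize ih fun t ht => hpt t (Finset.Icc_subset_Icc_right (Nat.le_succ n) ht)
    have hsplit : ∀ ω, Real.exp (∑ t ∈ Finset.Icc 1 (n + 1), U t ω) =
        Real.exp (∑ t ∈ Finset.Icc 1 n, U t ω) * Real.exp (U (n + 1) ω) := fun ω => by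
      rw [Finset.sum_Icc_succ_top (by omega), Real.exp_add]
    obtain ⟨c, hc⟩ := hbdd n
    obtain ⟨b, hb⟩ := hvb (n + 1) (by omega)
    have hi := hint (n + 1)
    simp only [hsplit] at hi ⊢
    refine (integral_mul_le_of_condExp (noiseSigma_le hξ.measurable n)
      (hξ.integrable (n + 1) (by omega)) (hξ.condExp_eq_zero (n + 1) (by omega))
      (hw (n + 1) (by omega)).1 (hw (n + 1) (by omega)).2 (hv (n + 1) (by omega)) hb
      (hmeas n).stronglyMeasurable (fun ω => (Real.exp_pos _).le) hc hi (hκ (n + 1))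
      (hpt (n + 1) (by simp))).trans ?_
    rw [Finset.sum_Icc_succ_top (by omega), mul_add, Real.exp_add, mul_comm]
    refine mul_le_mul ih ?_ (by have := hκ (n + 1); positivity) (Real.exp_pos _).le
    linarith [Real.add_one_le_exp (2 * κ (n + 1))]

/-- The tail bound behind the truncation of the noise. -/
lemma measureReal_lt_norm_le (hθ : 1 ≤ θ) (hφ : 0 < φ) (hξ : IsCenteredNoise μ ξ)
    (hw : IsCondSubWeibull μ ξ θ φ) {t : ℕ} (ht : 1 ≤ t) {a : ℝ} (ha : 0 ≤ a) :
    μ.real {ω | φ * a ^ θ < ‖ξ t ω‖} ≤ 2 * Real.exp (-a) := by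
  have hle := noiseSigma_le hξ.measurable (t - 1)
  have hE : ∫ ω, Real.exp ((‖ξ t ω‖ / φ) ^ (1 / θ)) ∂μ ≤ 2 := by
    rw [← integral_condExp hle]
    refine (integral_mono_ae integrable_condExp (integrable_const 2) (hw t ht).2).trans ?_
    simp
  have hM := mul_meas_ge_le_integral_of_nonneg
    (ae_of_all μ fun ω => (Real.exp_pos ((‖ξ t ω‖ / φ) ^ (1 / θ))).le) (hw t ht).1 (Real.exp a)
  have hsub : {ω | φ * a ^ θ < ‖ξ t ω‖} ⊆
      {ω | Real.exp a ≤ Real.exp ((‖ξ t ω‖ / φ) ^ (1 / θ))} := by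
    intro ω hω
    refine Real.exp_le_exp.2 ?_
    have h1 : a ^ θ ≤ ‖ξ t ω‖ / φ := by
      rw [le_div_iff₀ hφ, mul_comm]; exact le_of_lt hω
    calc a = (a ^ θ) ^ (1 / θ) := by
          rw [← Real.rpow_mul ha, mul_one_div_cancel (by linarith), Real.rpow_one]
      _ ≤ _ := Real.rpow_le_rpow (by positivity) h1 (by positivity)
  have h2 := measureReal_mono (μ := μ) hsub (measure_ne_top μ _)
  rw [Real.exp_neg, ← div_eq_mul_inv, le_div_iff₀ (Real.exp_pos a), mul_comm]
  exact (mul_le_mul_of_nonneg_left h2 (Real.exp_pos a).le).trans (hM.trans hE)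

end Probability

end SMD

/-! ### Scalar inequalities -/

namespace SMD

lemma exp_le_one_add_add_sq_of_nonpos {a : ℝ} (ha : a ≤ 0) : Real.exp a ≤ 1 + a + a ^ 2 := by
  have h := Real.quadratic_le_exp_of_nonneg (neg_nonneg.2 ha)
  have h1 : Real.exp a * Real.exp (-a) = 1 := by rw [← Real.exp_add]; simp
  have h2 : 1 ≤ (1 + a + a ^ 2) * Real.exp (-a) := by
    refine le_trans ?_ (mul_le_mul_of_nonneg_left h (by nlinarith))
    nlinarith [sq_nonneg a, sq_nonneg (a ^ 2), mul_nonneg (sq_nonneg a) (neg_nonneg.2 ha)]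
  exact le_of_mul_le_mul_right (h1.trans_le h2) (Real.exp_pos _)

lemma exp_add_le {a b : ℝ} (hb : 0 ≤ b) :
    Real.exp (a + b) ≤ 1 + a + (a ^ 2 + b) * Real.exp (|a| + b) := by
  have h1 : Real.exp a ≤ 1 + a + a ^ 2 * Real.exp |a| := by
    have h := Complex.norm_exp_sub_sum_le_norm_mul_exp (a : ℂ) 2
    rw [← Complex.ofReal_exp] at h
    have e : ((Real.exp a : ℝ) : ℂ) - ∑ m ∈ Finset.range 2, (a : ℂ) ^ m / (m.factorial : ℂ) =
        ((Real.exp a - (1 + a) : ℝ) : ℂ) := by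
      simp [Finset.sum_range_succ]
    rw [e, Complex.norm_real, Complex.norm_real, Real.norm_eq_abs, Real.norm_eq_abs, sq_abs] at h
    linarith [le_abs_self (Real.exp a - (1 + a))]
  have h2 : Real.exp b - 1 ≤ b * Real.exp b := by
    have h := mul_le_mul_of_nonneg_right (Real.add_one_le_exp (-b)) (Real.exp_pos b).le
    rw [← Real.exp_add, neg_add_cancel, Real.exp_zero] at h
    linarith
  have h3 : Real.exp a ≤ Real.exp |a| := Real.exp_le_exp.2 (le_abs_self a)
  have h4 : Real.exp a * (Real.exp b - 1) ≤ Real.exp |a| * (b * Real.exp b) :=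
    mul_le_mul h3 h2 (by linarith [Real.add_one_le_exp b]) (Real.exp_pos _).le
  have h5 : a ^ 2 * Real.exp |a| ≤ a ^ 2 * (Real.exp |a| * Real.exp b) :=
    mul_le_mul_of_nonneg_left
      (le_mul_of_one_le_right (Real.exp_pos _).le (Real.one_le_exp hb)) (sq_nonneg a)
  rw [Real.exp_add, Real.exp_add]
  nlinarith

lemma rpow_le_mul_exp {p c k : ℝ} (hp : 0 ≤ p) (hc : 0 < c) (hk : 0 < k) :
    p ^ c ≤ (c / k) ^ c * Real.exp (k * p) := by
  have h1 : p = c / k * (k * p / c) := by field_simp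
  have h2 : (k * p / c) ^ c ≤ Real.exp (k * p) := by
    calc (k * p / c) ^ c ≤ (Real.exp (k * p / c)) ^ c :=
          Real.rpow_le_rpow (by positivity)
            ((le_add_of_nonneg_right zero_le_one).trans (Real.add_one_le_exp _)) hc.le
      _ = Real.exp (k * p) := by
          rw [← Real.exp_mul]; congr 1; field_simp
  calc p ^ c = (c / k) ^ c * (k * p / c) ^ c := by
        rw [← Real.mul_rpow (by positivity) (by positivity), ← h1]
    _ ≤ _ := mul_le_mul_of_nonneg_left h2 (by positivity)

/-- The exponential of a truncated increment. Below the truncation level `A ^ θ` the increment is at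
most half of the sub-Weibull exponent `q ^ (1 / θ)`, so a second-order expansion of the exponential
is affordable; above it only the negative part of the linear term `a` is kept, whose exponential is
still dominated by the same expansion. In both cases the linear term on the right is the full `a`,
so truncation creates no bias. -/
lemma exp_truncated_le {θ A α β q a : ℝ} (hθ : 1 ≤ θ) (hA : 0 ≤ A) (hα : 0 ≤ α) (hβ : 0 ≤ β)
    (hq : 0 ≤ q) (ha : |a| ≤ α * q) (hαA : α * A ^ (θ - 1) ≤ 1 / 4)
    (hβA : β * A ^ (2 * θ - 1) ≤ 1 / 4) :
    Real.exp (if q ≤ A ^ θ then a + β * q ^ 2 else min a 0) ≤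
      1 + a + (4 * θ) ^ (2 * θ) * (α ^ 2 + β) * Real.exp (q ^ (1 / θ)) := by
  set p := q ^ (1 / θ) with hp
  have hθ0 : 0 < θ := by linarith
  have hp0 : 0 ≤ p := by positivity
  have hqp : q = p ^ θ := by
    rw [hp, ← Real.rpow_mul hq, one_div_mul_cancel hθ0.ne', Real.rpow_one]
  have hq2 : q ^ 2 = p ^ (2 * θ) := by
    rw [hqp, ← Real.rpow_natCast, ← Real.rpow_mul hp0]
    congr 1
    push_cast
    ring
  have hqK : q ^ 2 ≤ (4 * θ) ^ (2 * θ) * Real.exp (1 / 2 * p) := by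
    have := rpow_le_mul_exp hp0 (c := 2 * θ) (k := 1 / 2) (by positivity) (by norm_num)
    rwa [show 2 * θ / (1 / 2) = 4 * θ by ring, ← hq2] at this
  have ha2 : a ^ 2 ≤ α ^ 2 * q ^ 2 := by
    rw [← sq_abs a, ← mul_pow]
    exact pow_le_pow_left₀ (abs_nonneg a) ha 2
  have hsum : (a ^ 2 + β * q ^ 2) * Real.exp (1 / 2 * p) ≤
      (4 * θ) ^ (2 * θ) * (α ^ 2 + β) * Real.exp p := by
    have e : Real.exp p = Real.exp (1 / 2 * p) * Real.exp (1 / 2 * p) := by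
      rw [← Real.exp_add]; congr 1; ring
    rw [e, ← mul_assoc]
    refine mul_le_mul_of_nonneg_right ?_ (Real.exp_pos _).le
    calc a ^ 2 + β * q ^ 2 ≤ (α ^ 2 + β) * q ^ 2 := by linarith
      _ ≤ (α ^ 2 + β) * ((4 * θ) ^ (2 * θ) * Real.exp (1 / 2 * p)) :=
          mul_le_mul_of_nonneg_left hqK (by positivity)
      _ = _ := by ring
  split_ifs with hqA
  · have hpA : p ≤ A := by
      rw [hqp] at hqA
      exact (Real.rpow_le_rpow_iff hp0 hA hθ0).1 hqA
    have hsplit : ∀ c : ℝ, 1 ≤ c → p ^ c ≤ p * A ^ (c - 1) := fun c hc => by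
      rcases hp0.eq_or_lt with h0 | h0
      · rw [← h0, Real.zero_rpow (by linarith), zero_mul]
      · calc p ^ c = p * p ^ (c - 1) := by
              rw [← Real.rpow_one_add' hp0 (by linarith)]; congr 1; ring
          _ ≤ _ := mul_le_mul_of_nonneg_left
              (Real.rpow_le_rpow hp0 hpA (by linarith)) hp0
    have h1 : α * q ≤ 1 / 4 * p := by
      have := mul_le_mul_of_nonneg_left (hsplit θ hθ) hα
      rw [hqp]
      nlinarith
    have h2 : β * q ^ 2 ≤ 1 / 4 * p := by
      have := mul_le_mul_of_nonneg_left (hsplit (2 * θ) (by linarith)) hβ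
      rw [hq2]
      nlinarith
    have h3 : |a| + β * q ^ 2 ≤ 1 / 2 * p := by linarith
    have h4 : (a ^ 2 + β * q ^ 2) * Real.exp (|a| + β * q ^ 2) ≤
        (a ^ 2 + β * q ^ 2) * Real.exp (1 / 2 * p) :=
      mul_le_mul_of_nonneg_left (Real.exp_le_exp.2 h3) (by positivity)
    linarith [exp_add_le (a := a) (b := β * q ^ 2) (by positivity)]
  · rcases le_total 0 a with h0 | h0
    · rw [min_eq_right h0, Real.exp_zero]
      have : 0 ≤ (4 * θ) ^ (2 * θ) * (α ^ 2 + β) * Real.exp p := by positivity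
      linarith
    · rw [min_eq_left h0]
      have h1 : a ^ 2 + β * q ^ 2 ≤ (a ^ 2 + β * q ^ 2) * Real.exp (1 / 2 * p) :=
        le_mul_of_one_le_right (by positivity) (Real.one_le_exp (by positivity))
      have h2 : 0 ≤ β * q ^ 2 := by positivity
      linarith [exp_le_one_add_add_sq_of_nonpos h0]

end SMD

/-! ### Pathwise regret up to the exit from a ball -/

namespace SMD

section Confinement

variable {E Ω : Type*} [NormedAddCommGroup E] {x : ℕ → Ω → E}

/-- The sample paths whose first `t` iterates all lie within distance `R` of `u`. -/
def confined (x : ℕ → Ω → E) (u : E) (R : ℝ) (t : ℕ) : Set Ω :=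
  {ω | ∀ s ∈ Finset.Icc 1 t, ‖x s ω - u‖ ≤ R}

/-- The displacement `x t - u`, replaced by `0` once some iterate has left the ball of radius `R`
around `u`. -/
noncomputable def confinedDisplacement (x : ℕ → Ω → E) (u : E) (R : ℝ) (t : ℕ) : Ω → E :=
  (confined x u R t).indicator fun ω => x t ω - u

lemma norm_confinedDisplacement_le {u : E} {R : ℝ} (hR : 0 ≤ R) {t : ℕ} (ht : 1 ≤ t) (ω : Ω) :
    ‖confinedDisplacement x u R t ω‖ ≤ R := by
  unfold confinedDisplacement
  by_cases h : ω ∈ confined x u R t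
  · rw [Set.indicator_of_mem h]
    exact h t (Finset.mem_Icc.2 ⟨ht, le_rfl⟩)
  · rw [Set.indicator_of_notMem h, norm_zero]
    exact hR

end Confinement

section Pathwise

variable {E Ω : Type*} [NormedAddCommGroup E] [NormedSpace ℝ E]
  {X : Set E} {f : E → ℝ} {ψ : E → EReal} {η : ℕ → ℝ} {x₁ : E} {x : ℕ → Ω → E}
  {g ξ : ℕ → Ω → StrongDual ℝ E}

lemma IsSMDRun.regret_step (hrun : IsSMDRun X f ψ η x₁ x g ξ) (hψ : IsRegularizer X ψ)
    (hX : Convex ℝ X) (hη : ∀ t ≥ 1, 0 < η t) {u : E} (hu : u ∈ X) {G : ℝ}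
    {t : ℕ} (ht : 1 ≤ t) {ω : Ω} (hG : ‖g t ω‖ ≤ G) :
    η t * (f (x t ω) - f u) ≤ bregman ψ u (x t ω) - bregman ψ u (x (t + 1) ω) +
      (G ^ 2 * η t ^ 2 + (η t * ξ t ω (x t ω - u) + η t ^ 2 * ‖ξ t ω‖ ^ 2)) := by
  have h1 := hψ.mirror_step hX (hη t ht) (hrun.mem_interior hψ hX hη ht ω)
    (hrun.step_mem t ht ω) (hrun.mem_interior hψ hX hη (by omega) ω) hu (hrun.step_min t ht ω)
  have h2 := hrun.subgradient t ht ω u hu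
  have h3 : ‖g t ω - ξ t ω‖ ^ 2 ≤ 2 * G ^ 2 + 2 * ‖ξ t ω‖ ^ 2 := by
    have h4 : ‖g t ω - ξ t ω‖ ≤ G + ‖ξ t ω‖ := (norm_sub_le _ _).trans (by linarith)
    have h5 := pow_le_pow_left₀ (norm_nonneg _) h4 2
    linarith [sq_nonneg (G - ‖ξ t ω‖)]
  have h4 : η t * (f (x t ω) - f u) ≤ η t * g t ω (x t ω - u) := by
    refine mul_le_mul_of_nonneg_left ?_ (hη t ht).le
    rw [← neg_sub, map_neg] at h2
    linarith
  have h5 := mul_le_mul_of_nonneg_left h3 (show 0 ≤ η t ^ 2 / 2 by positivity)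
  rw [sub_apply] at h1
  linarith

lemma IsSMDRun.sum_regret_add_bregman_le (hrun : IsSMDRun X f ψ η x₁ x g ξ)
    (hψ : IsRegularizer X ψ) (hX : Convex ℝ X) (hη : ∀ t ≥ 1, 0 < η t) {u : E} (hu : u ∈ X) {G : ℝ}
    (hG : ∀ t ≥ 1, ∀ ω, ‖g t ω‖ ≤ G) (ω : Ω) (n : ℕ) :
    ∑ t ∈ Finset.Icc 1 n, η t * (f (x t ω) - f u) + bregman ψ u (x (n + 1) ω) ≤
      bregman ψ u x₁ + ∑ t ∈ Finset.Icc 1 n,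
        (G ^ 2 * η t ^ 2 + (η t * ξ t ω (x t ω - u) + η t ^ 2 * ‖ξ t ω‖ ^ 2)) := by
  induction n with
  | zero => simp [hrun.init_eq]
  | succ n ih =>
    rw [Finset.sum_Icc_succ_top (by omega), Finset.sum_Icc_succ_top (by omega)]
    have := hrun.regret_step hψ hX hη hu (t := n + 1) (by omega) (hG _ (by omega) ω)
    linarith

/-- If the noise accumulated before the exit from the ball of radius `R` around the minimizer is
small compared to `R ^ 2`, then the iterates never leave the ball, because the distance to the
minimizer is controlled by the Bregman divergence; hence the confined noise is the full noise and
the regret is at most `R ^ 2 / 2`. -/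
lemma IsSMDRun.sum_regret_le_of_confined (hrun : IsSMDRun X f ψ η x₁ x g ξ)
    (hψ : IsRegularizer X ψ) (hX : Convex ℝ X) (hη : ∀ t ≥ 1, 0 < η t) {u : E} (hu : u ∈ X)
    (hmin : IsMinOn f X u) {G : ℝ} (hG : ∀ t ≥ 1, ∀ ω, ‖g t ω‖ ≤ G) {R : ℝ} (hR : 0 ≤ R)
    {T : ℕ} {ω : Ω}
    (h : bregman ψ u x₁ + G ^ 2 * ∑ t ∈ Finset.Icc 1 T, η t ^ 2 +
      ∑ t ∈ Finset.Icc 1 T, (η t * ξ t ω (confinedDisplacement x u R t ω) +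
        η t ^ 2 * ‖ξ t ω‖ ^ 2) ≤ R ^ 2 / 2) :
    ∑ t ∈ Finset.Icc 1 T, η t * (f (x t ω) - f u) ≤ R ^ 2 / 2 := by
  rw [Finset.mul_sum, add_assoc, ← Finset.sum_add_distrib] at h
  have hreg := hrun.sum_regret_add_bregman_le hψ hX hη hu hG ω
  have huD := hψ.subset_domain hu
  have hB : ∀ t ≥ 1, 1 / 2 * ‖x t ω - u‖ ^ 2 ≤ bregman ψ u (x t ω) := fun t ht => by
    rw [norm_sub_rev]
    exact hψ.half_sq_norm_le_bregman huD (hrun.mem_interior hψ hX hη ht ω)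
  -- Before the exit time the confined displacement is the true one.
  have hcongr : ∀ n, ω ∈ confined x u R n → ∑ t ∈ Finset.Icc 1 n,
      (G ^ 2 * η t ^ 2 + (η t * ξ t ω (x t ω - u) + η t ^ 2 * ‖ξ t ω‖ ^ 2)) =
      ∑ t ∈ Finset.Icc 1 n, (G ^ 2 * η t ^ 2 +
        (η t * ξ t ω (confinedDisplacement x u R t ω) + η t ^ 2 * ‖ξ t ω‖ ^ 2)) := by
    intro n hn
    refine Finset.sum_congr rfl fun t ht => ?_
    have : ω ∈ confined x u R t := fun s hs =>
      hn s (Finset.Icc_subset_Icc_right (Finset.mem_Icc.1 ht).2 hs)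
    rw [confinedDisplacement, Set.indicator_of_mem this]
  have hconf : ∀ n ≤ T, ω ∈ confined x u R n := by
    intro n
    induction n with
    | zero => intro _ s hs; simp at hs
    | succ n ih =>
      intro hn
      have hc := ih (by omega)
      by_contra hout
      have hfar : R < ‖x (n + 1) ω - u‖ := by
        by_contra hle
        refine hout fun s hs => ?_
        rcases Nat.lt_or_ge n s with hs' | hs'
        · rw [le_antisymm (Finset.mem_Icc.1 hs).2 hs']; exact not_lt.1 hle
        · exact hc s (Finset.mem_Icc.2 ⟨(Finset.mem_Icc.1 hs).1, hs'⟩)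
      have hmono : ∑ t ∈ Finset.Icc 1 n, (G ^ 2 * η t ^ 2 +
            (η t * ξ t ω (confinedDisplacement x u R t ω) + η t ^ 2 * ‖ξ t ω‖ ^ 2)) ≤
          ∑ t ∈ Finset.Icc 1 T, (G ^ 2 * η t ^ 2 +
            (η t * ξ t ω (confinedDisplacement x u R t ω) + η t ^ 2 * ‖ξ t ω‖ ^ 2)) := by
        refine Finset.sum_le_sum_of_subset_of_nonneg
          (Finset.Icc_subset_Icc_right (by omega)) fun t ht ht' => ?_
        have hnt : n + 1 ≤ t := by
          simp only [Finset.mem_Icc] at ht ht'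
          omega
        have : ω ∉ confined x u R t := fun hm =>
          hout fun s hs => hm s (Finset.Icc_subset_Icc_right hnt hs)
        rw [confinedDisplacement, Set.indicator_of_notMem this, map_zero, mul_zero, zero_add]
        positivity
      have hnonneg : 0 ≤ ∑ t ∈ Finset.Icc 1 n, η t * (f (x t ω) - f u) :=
        Finset.sum_nonneg fun t ht => by
          have h1 : 1 ≤ t := (Finset.mem_Icc.1 ht).1
          exact mul_nonneg (hη t h1).le (sub_nonneg.2 (hmin (hrun.mem h1 ω)))
      have h1 := hreg n
      rw [hcongr n hc] at h1
      have h2 := hB (n + 1) (by omega)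
      have h3 := pow_lt_pow_left₀ hfar hR two_ne_zero
      linarith
  have h1 := hreg T
  rw [hcongr T (hconf T le_rfl)] at h1
  have h2 := hB (T + 1) (by omega)
  have h3 := sq_nonneg ‖x (T + 1) ω - u‖
  linarith

end Pathwise

end SMD

/-! ### The high-probability regret bound -/

namespace SMD

section HighProbability

variable {E Ω : Type*} [NormedAddCommGroup E] [NormedSpace ℝ E] {ξ : ℕ → Ω → StrongDual ℝ E}

lemma stronglyMeasurable_confinedDisplacement {x : ℕ → Ω → E}
    (hx : ∀ t ≥ 1, StronglyMeasurable[noiseSigma ξ (t - 1)] (x t)) (u : E) (R : ℝ) {t : ℕ}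
    (ht : 1 ≤ t) : StronglyMeasurable[noiseSigma ξ (t - 1)] (confinedDisplacement x u R t) := by
  refine StronglyMeasurable.indicator ((hx t ht).sub stronglyMeasurable_const) ?_
  have : confined x u R t = ⋂ s ∈ Finset.Icc 1 t, {ω | ‖x s ω - u‖ ≤ R} := by
    ext ω; simp [confined]
  rw [this]
  refine Finset.measurableSet_biInter _ fun s hs => ?_
  have hs' := Finset.mem_Icc.1 hs
  have h1 : StronglyMeasurable[noiseSigma ξ (t - 1)] fun ω => ‖x s ω - u‖ :=
    (((hx s hs'.1).mono (noiseSigma_mono ξ (by omega))).sub stronglyMeasurable_const).norm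
  exact h1.measurable measurableSet_Iic

/-- The level at which the sub-Weibull exponent of the noise at time `t` is truncated; the factor
`t ^ 2` makes the failure probabilities summable, uniformly in the horizon. -/
noncomputable def truncLevel (δ : ℝ) (t : ℕ) : ℝ := Real.log (8 * (t : ℝ) ^ 2 / δ)

lemma exp_neg_truncLevel {δ : ℝ} (hδ : 0 < δ) {t : ℕ} (ht : 1 ≤ t) :
    Real.exp (-truncLevel δ t) = δ / 8 * ((t : ℝ) ^ 2)⁻¹ := by
  have : (0 : ℝ) < t := by exact_mod_cast ht
  rw [truncLevel, ← Real.log_inv, Real.exp_log (by positivity)]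
  field_simp

lemma one_le_log_exp_div {δ : ℝ} (hδ : 0 < δ) (hδ1 : δ < 1) :
    1 ≤ Real.log (Real.exp 1 / δ) := by
  rw [Real.log_div (Real.exp_pos 1).ne' hδ.ne', Real.log_exp]
  linarith [Real.log_neg hδ hδ1]

lemma log_exp_div_le_truncLevel {δ : ℝ} (hδ : 0 < δ) {t : ℕ} (ht : 1 ≤ t) :
    Real.log (Real.exp 1 / δ) ≤ truncLevel δ t := by
  refine Real.log_le_log (by positivity) (div_le_div_of_nonneg_right ?_ hδ.le)
  have : (1 : ℝ) ≤ (t : ℝ) ^ 2 := one_le_pow₀ (by exact_mod_cast ht)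
  linarith [Real.exp_one_lt_d9]

lemma sum_Icc_inv_sq_le (T : ℕ) : ∑ t ∈ Finset.Icc 1 T, ((t : ℝ) ^ 2)⁻¹ ≤ 2 := by
  have h := sum_Ioo_inv_sq_le (α := ℝ) 0 (T + 1)
  have e : Finset.Ioo 0 (T + 1) = Finset.Icc 1 T := by
    ext t; simp only [Finset.mem_Ioo, Finset.mem_Icc]; omega
  rw [e] at h
  simpa using h

/-- The exponential increment of the supermartingale: `z` is the noise, `d` the confined
displacement, `A` the truncation level. -/
noncomputable def truncatedIncrement (θ φ s η A : ℝ) (z : StrongDual ℝ E) (d : E) : ℝ :=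
  if ‖z‖ / φ ≤ A ^ θ then s * (η * z d) + s * η ^ 2 * φ ^ 2 * (‖z‖ / φ) ^ 2
  else min (s * (η * z d)) 0

lemma truncatedIncrement_of_le {θ φ s η A : ℝ} (hφ : 0 < φ) {z : StrongDual ℝ E} {d : E}
    (h : ‖z‖ ≤ φ * A ^ θ) :
    truncatedIncrement θ φ s η A z d = s * (η * z d + η ^ 2 * ‖z‖ ^ 2) := by
  rw [truncatedIncrement, if_pos (by rwa [div_le_iff₀ hφ, mul_comm])]
  field_simp

lemma truncatedIncrement_le {θ φ s η A R : ℝ} (hφ : 0 < φ) (hs : 0 ≤ s) (hη : 0 ≤ η)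
    (hA : 0 ≤ A) (hR : 0 ≤ R) {z : StrongDual ℝ E} {d : E} (hd : ‖d‖ ≤ R) :
    truncatedIncrement θ φ s η A z d ≤
      s * (η * (φ * A ^ θ * R)) + s * η ^ 2 * φ ^ 2 * (A ^ θ) ^ 2 := by
  unfold truncatedIncrement
  split_ifs with h
  · have h1 : z d ≤ φ * A ^ θ * R := by
      refine (le_abs_self _).trans ((z.le_opNorm d).trans ?_)
      refine mul_le_mul ?_ hd (norm_nonneg _) (by positivity)
      rwa [div_le_iff₀ hφ, mul_comm] at h
    have h2 : (‖z‖ / φ) ^ 2 ≤ (A ^ θ) ^ 2 := pow_le_pow_left₀ (by positivity) h 2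
    gcongr
  · exact (min_le_right _ _).trans (by positivity)

lemma exp_truncatedIncrement_le {θ φ s η A R : ℝ} (hθ : 1 ≤ θ) (hφ : 0 < φ) (hs : 0 ≤ s)
    (hη : 0 ≤ η) (hA : 0 ≤ A) (hR : 0 ≤ R) (h1 : s * η * R * φ * A ^ (θ - 1) ≤ 1 / 4)
    (h2 : s * η ^ 2 * φ ^ 2 * A ^ (2 * θ - 1) ≤ 1 / 4) {z : StrongDual ℝ E} {d : E}
    (hd : ‖d‖ ≤ R) :
    Real.exp (truncatedIncrement θ φ s η A z d) ≤ 1 + z ((s * η) • d) +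
      (4 * θ) ^ (2 * θ) * ((s * η * R * φ) ^ 2 + s * η ^ 2 * φ ^ 2) *
        Real.exp ((‖z‖ / φ) ^ (1 / θ)) := by
  have e : z ((s * η) • d) = s * (η * z d) := by rw [map_smul, smul_eq_mul, mul_assoc]
  rw [e]
  refine exp_truncated_le hθ hA (by positivity) (by positivity) (by positivity) ?_ h1 h2
  rw [abs_mul, abs_mul, abs_of_nonneg hs, abs_of_nonneg hη]
  have h3 : |z d| ≤ ‖z‖ * R :=
    (z.le_opNorm d).trans (mul_le_mul_of_nonneg_left hd (norm_nonneg _))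
  calc s * (η * |z d|) ≤ s * (η * (‖z‖ * R)) := by gcongr
    _ = s * η * R * φ * (‖z‖ / φ) := by field_simp

variable [MeasurableSpace Ω] {μ : Measure Ω} [IsProbabilityMeasure μ] {θ φ : ℝ}

/-- With probability at least `1 - δ`, the confined noise in the first `T` steps is at most its
variance proxy plus `R ^ 2 / 4`. The exponential moment parameter is `4 * log (e / δ) / R ^ 2`; the
hypothesis on `R` makes it small enough for the truncated increments. -/
lemma holdsWithProb_confined_noise [FiniteDimensional ℝ E] (hθ : 1 ≤ θ) (hφ : 0 < φ)
    (hξ : IsCenteredNoise μ ξ) (hw : IsCondSubWeibull μ ξ θ φ) {δ : ℝ} (hδ : 0 < δ) (hδ1 : δ < 1)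
    {x : ℕ → Ω → E} (hx : ∀ t ≥ 1, StronglyMeasurable[noiseSigma ξ (t - 1)] (x t)) (u : E)
    {η : ℕ → ℝ} (hη : ∀ t ≥ 1, 0 < η t) {T : ℕ} {R : ℝ} (hR : 0 < R)
    (hRη : ∀ t ∈ Finset.Icc 1 T,
      256 * φ ^ 2 * (η t ^ 2 * truncLevel δ t ^ (2 * θ)) ≤ R ^ 2) :
    HoldsWithProb μ (1 - δ) fun ω =>
      ∑ t ∈ Finset.Icc 1 T, (η t * ξ t ω (confinedDisplacement x u R t ω) +
        η t ^ 2 * ‖ξ t ω‖ ^ 2) ≤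
      10 * (4 * θ) ^ (2 * θ) * φ ^ 2 * (∑ t ∈ Finset.Icc 1 T, η t ^ 2) *
        Real.log (Real.exp 1 / δ) + R ^ 2 / 4 := by
  set l := Real.log (Real.exp 1 / δ) with hl
  have hl1 : 1 ≤ l := one_le_log_exp_div hδ hδ1
  have hla : ∀ t ≥ 1, l ≤ truncLevel δ t := fun t ht => log_exp_div_le_truncLevel hδ ht
  have ha0 : ∀ t ≥ 1, 0 < truncLevel δ t := fun t ht => by linarith [hla t ht]
  set s := 4 * l / R ^ 2 with hs
  have hs0 : 0 < s := by positivity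
  have hsR : s * R ^ 2 = 4 * l := by rw [hs]; field_simp
  set K := (4 * θ) ^ (2 * θ) with hK
  have hK0 : 0 < K := by positivity
  set d : ℕ → Ω → E := confinedDisplacement x u R with hd
  have hdR : ∀ t ≥ 1, ∀ ω, ‖d t ω‖ ≤ R := fun t ht ω => norm_confinedDisplacement_le hR.le ht ω
  set κ : ℕ → ℝ := fun t => K * ((s * η t * R * φ) ^ 2 + s * η t ^ 2 * φ ^ 2) with hκ
  set U : ℕ → Ω → ℝ := fun t ω =>
    truncatedIncrement θ φ s (η t) (truncLevel δ t) (ξ t ω) (d t ω) with hU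
  have hdm : ∀ t ≥ 1, StronglyMeasurable[noiseSigma ξ (t - 1)] (d t) := fun t ht =>
    stronglyMeasurable_confinedDisplacement hx u R ht
  have hUm : ∀ t ≥ 1, Measurable[noiseSigma ξ t] (U t) := by
    intro t ht
    have hξm : StronglyMeasurable[noiseSigma ξ t] (ξ t) :=
      (measurable_noiseSigma ξ ht).stronglyMeasurable
    have hpair : Measurable[noiseSigma ξ t] fun ω => s * (η t * ξ t ω (d t ω)) := by
      have : StronglyMeasurable[noiseSigma ξ t] fun ω => ξ t ω (d t ω) :=
        (isBoundedBilinearMap_apply (𝕜 := ℝ) (E := E) (F := ℝ)).continuous.comp_stronglyMeasurable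
          (hξm.prodMk ((hdm t ht).mono (noiseSigma_mono ξ (Nat.sub_le t 1))))
      exact (this.measurable.const_mul _).const_mul _
    have hnorm : Measurable[noiseSigma ξ t] fun ω => ‖ξ t ω‖ / φ :=
      hξm.norm.measurable.div_const _
    exact Measurable.ite (hnorm measurableSet_Iic)
      (hpair.add ((hnorm.pow_const 2).const_mul _)) (hpair.min measurable_const)
  have hpt : ∀ t ∈ Finset.Icc 1 T, ∀ ω, Real.exp (U t ω) ≤
      1 + ξ t ω ((s * η t) • d t ω) + κ t * Real.exp ((‖ξ t ω‖ / φ) ^ (1 / θ)) := by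
    intro t ht ω
    have ht1 := (Finset.mem_Icc.1 ht).1
    have hη0 := hη t ht1
    have hA := ha0 t ht1
    set A := truncLevel δ t
    have hlA : l ≤ A := hla t ht1
    have hRA := hRη t ht
    refine exp_truncatedIncrement_le hθ hφ hs0.le hη0.le hA.le hR.le ?_ ?_ (hdR t ht1 ω)
    · have h1 : (16 * φ * η t * A ^ θ) ^ 2 ≤ R ^ 2 := by
        refine le_trans (le_of_eq ?_) hRA
        rw [mul_comm 2 θ, Real.rpow_mul hA.le, Real.rpow_two]
        ring
      have h2 : 16 * φ * η t * A ^ θ ≤ R := (sq_le_sq₀ (by positivity) hR.le).1 h1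
      have h3 : l * A ^ (θ - 1) ≤ A ^ θ := by
        calc l * A ^ (θ - 1) ≤ A * A ^ (θ - 1) := by gcongr
          _ = A ^ θ := by rw [← Real.rpow_one_add' hA.le (by linarith)]; congr 1; ring
      have h4 : 16 * φ * η t * (l * A ^ (θ - 1)) ≤ R :=
        (mul_le_mul_of_nonneg_left h3 (by positivity)).trans h2
      have e : s * η t * R * φ * A ^ (θ - 1) = (16 * φ * η t * (l * A ^ (θ - 1))) / (4 * R) := by
        rw [hs]; field_simp; ring
      rw [e, div_le_iff₀ (by positivity)]
      linarith
    · have h3 : l * A ^ (2 * θ - 1) ≤ A ^ (2 * θ) := by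
        calc l * A ^ (2 * θ - 1) ≤ A * A ^ (2 * θ - 1) := by gcongr
          _ = A ^ (2 * θ) := by rw [← Real.rpow_one_add' hA.le (by linarith)]; congr 1; ring
      have h4 : φ ^ 2 * η t ^ 2 * (l * A ^ (2 * θ - 1)) ≤ φ ^ 2 * η t ^ 2 * A ^ (2 * θ) :=
        mul_le_mul_of_nonneg_left h3 (by positivity)
      have h5 : 0 ≤ φ ^ 2 * η t ^ 2 * A ^ (2 * θ) := by positivity
      have e : s * η t ^ 2 * φ ^ 2 * A ^ (2 * θ - 1) =
          (4 * (φ ^ 2 * η t ^ 2 * (l * A ^ (2 * θ - 1)))) / R ^ 2 := by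
        rw [hs]; field_simp
      rw [e, div_le_iff₀ (by positivity)]
      linarith
  obtain ⟨hint, hexp⟩ := integral_exp_sum_le hξ hw (v := fun t ω => (s * η t) • d t ω)
    (fun t ht => (hdm t ht).const_smul _)
    (fun t ht => ⟨s * η t * R, fun ω => by
      have := hη t ht
      rw [norm_smul, Real.norm_of_nonneg (by positivity)]
      exact mul_le_mul_of_nonneg_left (hdR t ht ω) (by positivity)⟩)
    hUm
    (fun t ht => ⟨_, fun ω => truncatedIncrement_le hφ hs0.le (hη t ht).le (ha0 t ht).le hR.le
      (hdR t ht ω)⟩)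
    (κ := κ) (fun t => by positivity) hpt
  set L := 2 * ∑ t ∈ Finset.Icc 1 T, κ t with hL
  set bad : Set Ω := {ω | Real.exp (L + l) ≤ Real.exp (∑ t ∈ Finset.Icc 1 T, U t ω)} with hbad
  set large : ℕ → Set Ω := fun t => {ω | φ * truncLevel δ t ^ θ < ‖ξ t ω‖} with hlarge
  have hbadm : MeasurableSet bad := by
    refine measurableSet_le measurable_const (Real.measurable_exp.comp ?_)
    exact Finset.measurable_fun_sum _ fun t ht =>
      (hUm t (Finset.mem_Icc.1 ht).1).mono (noiseSigma_le hξ.measurable t) le_rfl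
  have hlargem : ∀ t ∈ Finset.Icc 1 T, MeasurableSet (large t) := fun t ht =>
    measurableSet_lt measurable_const (hξ.measurable t (Finset.mem_Icc.1 ht).1).norm
  have hbadle : μ.real bad ≤ δ / 2 := by
    have h1 := mul_meas_ge_le_integral_of_nonneg
      (ae_of_all μ fun ω => (Real.exp_pos (∑ t ∈ Finset.Icc 1 T, U t ω)).le) hint
      (Real.exp (L + l))
    have h2 : Real.exp (L + l) * μ.real bad ≤ Real.exp L := h1.trans hexp
    rw [Real.exp_add, mul_assoc] at h2
    have h3 : Real.exp l * μ.real bad ≤ 1 := by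
      refine le_of_mul_le_mul_left (h2.trans_eq (mul_one _).symm) (Real.exp_pos L)
    rw [hl, Real.exp_log (by positivity), div_mul_eq_mul_div, div_le_one hδ] at h3
    have h4 : 2 * μ.real bad ≤ Real.exp 1 * μ.real bad :=
      mul_le_mul_of_nonneg_right (by linarith [Real.add_one_le_exp 1]) measureReal_nonneg
    linarith
  have hlargele : μ.real (⋃ t ∈ Finset.Icc 1 T, large t) ≤ δ / 2 := by
    refine (measureReal_biUnion_finset_le _ _).trans ?_
    calc ∑ t ∈ Finset.Icc 1 T, μ.real (large t)
        ≤ ∑ t ∈ Finset.Icc 1 T, δ / 4 * ((t : ℝ) ^ 2)⁻¹ := by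
          refine Finset.sum_le_sum fun t ht => ?_
          have ht1 := (Finset.mem_Icc.1 ht).1
          refine (measureReal_lt_norm_le hθ hφ hξ hw ht1 (ha0 t ht1).le).trans_eq ?_
          rw [exp_neg_truncLevel hδ ht1]
          ring
      _ ≤ δ / 2 := by
          rw [← Finset.mul_sum]
          have := mul_le_mul_of_nonneg_left (sum_Icc_inv_sq_le T) (show 0 ≤ δ / 4 by positivity)
          linarith
  have hunion : MeasurableSet (bad ∪ ⋃ t ∈ Finset.Icc 1 T, large t) :=
    hbadm.union (Finset.measurableSet_biUnion _ hlargem)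
  refine ⟨(bad ∪ ⋃ t ∈ Finset.Icc 1 T, large t)ᶜ, hunion.compl, ?_, fun ω hω => ?_⟩
  · have h1 : 1 - δ ≤ μ.real (bad ∪ ⋃ t ∈ Finset.Icc 1 T, large t)ᶜ := by
      rw [probReal_compl_eq_one_sub hunion]
      linarith [measureReal_union_le (μ := μ) bad (⋃ t ∈ Finset.Icc 1 T, large t)]
    exact ENNReal.ofReal_le_of_le_toReal h1
  · simp only [Set.mem_compl_iff, Set.mem_union, not_or, Set.mem_iUnion, not_exists] at hω
    obtain ⟨hω1, hω2⟩ := hω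
    have hsum : ∑ t ∈ Finset.Icc 1 T, U t ω < L + l := by
      rw [hbad] at hω1
      exact Real.exp_lt_exp.1 (not_le.1 hω1)
    have hUeq : ∑ t ∈ Finset.Icc 1 T, U t ω = s * ∑ t ∈ Finset.Icc 1 T,
        (η t * ξ t ω (d t ω) + η t ^ 2 * ‖ξ t ω‖ ^ 2) := by
      rw [Finset.mul_sum]
      exact Finset.sum_congr rfl fun t ht => truncatedIncrement_of_le hφ (not_lt.1 (hω2 t ht))
    have hκeq : L = s * (2 * K * φ ^ 2 * (∑ t ∈ Finset.Icc 1 T, η t ^ 2) * (4 * l + 1)) := by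
      rw [hL, ← hsR]
      simp only [Finset.mul_sum, Finset.sum_mul]
      refine Finset.sum_congr rfl fun t _ => ?_
      simp only [hκ]
      ring
    have hleq : l = s * (R ^ 2 / 4) := by linarith
    rw [hUeq] at hsum
    have h1 : s * ∑ t ∈ Finset.Icc 1 T, (η t * ξ t ω (d t ω) + η t ^ 2 * ‖ξ t ω‖ ^ 2) ≤
        s * (2 * K * φ ^ 2 * (∑ t ∈ Finset.Icc 1 T, η t ^ 2) * (4 * l + 1) + R ^ 2 / 4) := by
      linarith
    refine (le_of_mul_le_mul_left h1 hs0).trans ?_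
    have h2 : 0 ≤ K * φ ^ 2 * (∑ t ∈ Finset.Icc 1 T, η t ^ 2) :=
      mul_nonneg (by positivity) (Finset.sum_nonneg fun t _ => sq_nonneg _)
    have h3 := mul_le_mul_of_nonneg_left hl1 h2
    linarith

/-- The high-probability regret bound for arbitrary step sizes. The radius of the ball in which the
iterates are confined is chosen so that the noise fits in `R ^ 2 / 2`. -/
lemma IsSMDRun.holdsWithProb_sum_regret_le [FiniteDimensional ℝ E] (hθ : 1 ≤ θ) (hφ : 0 < φ)
    (hξ : IsCenteredNoise μ ξ) (hw : IsCondSubWeibull μ ξ θ φ) {δ : ℝ} (hδ : 0 < δ) (hδ1 : δ < 1)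
    {X : Set E} {f : E → ℝ} {ψ : E → EReal} {η : ℕ → ℝ} {x₁ : E} {x : ℕ → Ω → E}
    {g : ℕ → Ω → StrongDual ℝ E} (hrun : IsSMDRun X f ψ η x₁ x g ξ)
    (hψ : IsRegularizer X ψ) (hX : Convex ℝ X) (hη : ∀ t ≥ 1, 0 < η t) {u : E} (hu : u ∈ X)
    (hmin : IsMinOn f X u) {G : ℝ} (hG0 : 0 < G) (hG : ∀ t ≥ 1, ∀ ω, ‖g t ω‖ ≤ G) {T : ℕ}
    (hT : 1 ≤ T) {S H : ℝ} (hS : ∑ t ∈ Finset.Icc 1 T, η t ^ 2 ≤ S)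
    (hH : ∀ t ∈ Finset.Icc 1 T, η t ^ 2 * truncLevel δ t ^ (2 * θ) ≤ H) :
    HoldsWithProb μ (1 - δ) fun ω => ∑ t ∈ Finset.Icc 1 T, η t * (f (x t ω) - f u) ≤
      2 * (bregman ψ u x₁ + G ^ 2 * S +
        10 * (4 * θ) ^ (2 * θ) * φ ^ 2 * S * Real.log (Real.exp 1 / δ)) + 128 * φ ^ 2 * H := by
  have hl1 := one_le_log_exp_div hδ hδ1
  set l := Real.log (Real.exp 1 / δ)
  set K := (4 * θ) ^ (2 * θ) with hK
  have hK0 : 0 < K := by positivity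
  have hB : 0 ≤ bregman ψ u x₁ := le_trans (by positivity)
    (hψ.half_sq_norm_le_bregman (hψ.subset_domain hu) hrun.init_mem_interior)
  have h1T : 1 ∈ Finset.Icc 1 T := Finset.mem_Icc.2 ⟨le_rfl, hT⟩
  have hS0 : 0 < S := by
    refine lt_of_lt_of_le (Finset.sum_pos (fun t ht => ?_) ⟨1, h1T⟩) hS
    exact pow_pos (hη t (Finset.mem_Icc.1 ht).1) 2
  have hH0 : 0 ≤ H := by
    refine le_trans ?_ (hH 1 h1T)
    have : 0 ≤ truncLevel δ 1 := by linarith [log_exp_div_le_truncLevel hδ le_rfl]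
    positivity
  set Q := 4 * (bregman ψ u x₁ + G ^ 2 * S + 10 * K * φ ^ 2 * S * l) + 256 * φ ^ 2 * H with hQ
  have hQ0 : 0 < Q := by positivity
  have hR2 : √Q ^ 2 = Q := Real.sq_sqrt hQ0.le
  obtain ⟨A, hA, hμA, hA'⟩ := holdsWithProb_confined_noise hθ hφ hξ hw hδ hδ1
    (fun t ht => hrun.stronglyMeasurable_iterate hψ hX hη ht) u hη (T := T) (Real.sqrt_pos.2 hQ0)
    (fun t ht => by
      rw [hR2]
      have h1 := mul_le_mul_of_nonneg_left (hH t ht) (show 0 ≤ 256 * φ ^ 2 by positivity)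
      have h2 : 0 ≤ 4 * (bregman ψ u x₁ + G ^ 2 * S + 10 * K * φ ^ 2 * S * l) := by positivity
      linarith)
  refine ⟨A, hA, hμA, fun ω hω => ?_⟩
  have h1 := hA' ω hω
  rw [hR2] at h1
  have h2 : 10 * K * φ ^ 2 * (∑ t ∈ Finset.Icc 1 T, η t ^ 2) * l ≤ 10 * K * φ ^ 2 * S * l := by
    gcongr
  have h3 : G ^ 2 * ∑ t ∈ Finset.Icc 1 T, η t ^ 2 ≤ G ^ 2 * S := by gcongr
  have h4 : 0 ≤ 256 * φ ^ 2 * H := by positivity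
  have h5 := hrun.sum_regret_le_of_confined hψ hX hη hu hmin hG (Real.sqrt_nonneg Q) (T := T)
    (ω := ω) (by rw [hR2]; linarith)
  rw [hR2] at h5
  linarith

end HighProbability

end SMD

/-! ### The two step-size schedules -/

namespace SMD

lemma truncLevel_le {δ : ℝ} (hδ : 0 < δ) (hδ1 : δ < 1) {t : ℕ} (ht : 1 ≤ t) :
    truncLevel δ t ≤ 3 * Real.log (Real.exp 1 * t / δ) := by
  have ht1 : (1 : ℝ) ≤ t := by exact_mod_cast ht
  have h8 : (8 : ℝ) ≤ Real.exp 1 ^ 3 := by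
    have := pow_le_pow_left₀ (by norm_num) (show (2 : ℝ) ≤ Real.exp 1 by
      linarith [Real.add_one_le_exp 1]) 3
    linarith
  have hδ3 : δ ^ 3 ≤ δ := pow_le_of_le_one hδ.le hδ1.le (by norm_num)
  rw [truncLevel, show (3 : ℝ) = ((3 : ℕ) : ℝ) by norm_num, ← Real.log_pow]
  refine Real.log_le_log (by positivity) ?_
  rw [div_pow, mul_pow]
  gcongr
  · norm_num

lemma log_exp_mul_div_le {δ : ℝ} (hδ : 0 < δ) (hδ1 : δ < 1) {t : ℕ} (ht : 1 ≤ t) :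
    Real.log (Real.exp 1 * t / δ) ≤ Real.log (Real.exp 1 / δ) * Real.log (Real.exp 1 * t) := by
  have ht1 : (1 : ℝ) ≤ t := by exact_mod_cast ht
  have h1 := one_le_log_exp_div hδ hδ1
  have h2 : Real.log (Real.exp 1 * t / δ) = Real.log (Real.exp 1 / δ) + Real.log t := by
    rw [mul_div_right_comm, Real.log_mul (by positivity) (by positivity)]
  have h3 : Real.log (Real.exp 1 * t) = 1 + Real.log t := by
    rw [Real.log_mul (by positivity) (by positivity), Real.log_exp]
  rw [h2, h3]
  linarith [mul_le_mul_of_nonneg_right h1 (Real.log_nonneg ht1)]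

/-- For step sizes proportional to `1 / √t`, the decay of the squared step size absorbs the growth
in `t` of the truncation level. -/
lemma truncLevel_rpow_le {θ δ : ℝ} (hθ : 1 ≤ θ) (hδ : 0 < δ) (hδ1 : δ < 1) {t : ℕ} (ht : 1 ≤ t) :
    truncLevel δ t ^ (2 * θ) ≤ 3 ^ (2 * θ) * Real.log (Real.exp 1 / δ) ^ (2 * θ) *
      ((2 * θ) ^ (2 * θ) * Real.exp 1) * t := by
  have ht1 : (1 : ℝ) ≤ t := by exact_mod_cast ht
  have hl := one_le_log_exp_div hδ hδ1
  have hlog : 0 ≤ Real.log (Real.exp 1 * t) :=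
    Real.log_nonneg (one_le_mul_of_one_le_of_one_le (Real.one_le_exp zero_le_one) ht1)
  have h0 : 0 ≤ truncLevel δ t := by linarith [log_exp_div_le_truncLevel hδ ht]
  have h1 : truncLevel δ t ≤ 3 * (Real.log (Real.exp 1 / δ) * Real.log (Real.exp 1 * t)) := by
    linarith [truncLevel_le hδ hδ1 ht, log_exp_mul_div_le hδ hδ1 ht]
  have h2 : Real.log (Real.exp 1 * t) ^ (2 * θ) ≤ (2 * θ) ^ (2 * θ) * (Real.exp 1 * t) := by
    have := rpow_le_mul_exp hlog (c := 2 * θ) (k := 1) (by linarith) one_pos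
    rwa [div_one, one_mul, Real.exp_log (by positivity)] at this
  calc truncLevel δ t ^ (2 * θ)
      ≤ (3 * (Real.log (Real.exp 1 / δ) * Real.log (Real.exp 1 * t))) ^ (2 * θ) :=
        Real.rpow_le_rpow h0 h1 (by linarith)
    _ = 3 ^ (2 * θ) * Real.log (Real.exp 1 / δ) ^ (2 * θ) *
          Real.log (Real.exp 1 * t) ^ (2 * θ) := by
        rw [Real.mul_rpow (by norm_num) (by positivity), Real.mul_rpow (by linarith) hlog,
          mul_assoc]
    _ ≤ 3 ^ (2 * θ) * Real.log (Real.exp 1 / δ) ^ (2 * θ) *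
          ((2 * θ) ^ (2 * θ) * (Real.exp 1 * t)) :=
        mul_le_mul_of_nonneg_left h2 (by positivity)
    _ = _ := by ring

lemma sum_sq_div_sqrt_le {η : ℝ} {T : ℕ} (hT : 1 ≤ T) :
    ∑ t ∈ Finset.Icc 1 T, (η / √(t : ℝ)) ^ 2 ≤ η ^ 2 * Real.log (Real.exp 1 * T) := by
  have hT0 : (0 : ℝ) < T := by exact_mod_cast hT
  have h := harmonic_le_one_add_log T
  rw [harmonic_eq_sum_Icc] at h
  push_cast at h
  rw [Real.log_mul (Real.exp_pos 1).ne' hT0.ne', Real.log_exp]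
  refine le_trans (le_of_eq ?_) (mul_le_mul_of_nonneg_left h (sq_nonneg η))
  rw [Finset.mul_sum]
  refine Finset.sum_congr rfl fun t _ => ?_
  rw [div_pow, Real.sq_sqrt (Nat.cast_nonneg t), div_eq_mul_inv]

/-- Jensen's inequality for the average iterate. -/
lemma IsSMDRun.mul_gap_avgIterate_le {E Ω : Type*} [NormedAddCommGroup E] [NormedSpace ℝ E]
    {X : Set E} {f : E → ℝ} {ψ : E → EReal} {η : ℕ → ℝ} {x₁ : E} {x : ℕ → Ω → E}
    {g ξ : ℕ → Ω → StrongDual ℝ E} (hrun : IsSMDRun X f ψ η x₁ x g ξ) (hf : ConvexOn ℝ X f)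
    {T : ℕ} (hT : 1 ≤ T) (c : ℝ) (ω : Ω) :
    T * (f (avgIterate x T ω) - c) ≤ ∑ t ∈ Finset.Icc 1 T, (f (x t ω) - c) := by
  have hT0 : (0 : ℝ) < T := by exact_mod_cast hT
  have h := hf.map_sum_le (t := Finset.Icc 1 T) (w := fun _ => 1 / (T : ℝ)) (p := fun t => x t ω)
    (fun _ _ => by positivity) (by simp [hT0.ne']) (fun t ht => hrun.mem (Finset.mem_Icc.1 ht).1 ω)
  rw [← Finset.smul_sum, ← Finset.smul_sum, smul_eq_mul, one_div_mul_eq_div,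
    le_div_iff₀ hT0] at h
  have e : avgIterate x T ω = (1 / (T : ℝ)) • ∑ t ∈ Finset.Icc 1 T, x t ω := rfl
  rw [Finset.sum_sub_distrib, e]
  simp only [Finset.sum_const, Nat.card_Icc, Nat.add_sub_cancel, nsmul_eq_mul]
  linarith

end SMD

theorem corollary1 (θ : ℝ) (hθ : 1 ≤ θ) :
    ∃ C : ℝ, 0 < C ∧
      ∀ (E : Type*) [NormedAddCommGroup E] [NormedSpace ℝ E] [FiniteDimensional ℝ E]
        (Ω : Type*) [MeasurableSpace Ω] (μ : Measure Ω) [IsProbabilityMeasure μ]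
        (X : Set E) (f : E → ℝ) (xstar : E) (ψ : E → EReal) (x₁ : E)
        (x : ℕ → Ω → E) (g ξ : ℕ → Ω → StrongDual ℝ E)
        (G φ η δ : ℝ) (T : ℕ),
        IsClosed X → ConvexOn ℝ X f → xstar ∈ X → IsMinOn f X xstar →
        SMD.IsRegularizer X ψ →
        0 < G → (∀ t ≥ 1, ∀ ω, ‖g t ω‖ ≤ G) →
        SMD.IsCenteredNoise μ ξ →
        0 < φ → SMD.IsCondSubWeibull μ ξ θ φ →
        0 < η → 0 < δ → δ < 1 → 1 ≤ T →
        (SMD.IsSMDRun X f ψ (fun _ => η) x₁ x g ξ →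
          SMD.HoldsWithProb μ (1 - δ) (fun ω =>
            f (SMD.avgIterate x T ω) - f xstar ≤
              C / T * (SMD.bregman ψ xstar x₁ / η
                + η * (G ^ 2 + φ ^ 2 * Real.log (Real.exp 1 / δ)) * T
                + η * φ ^ 2 * Real.log (Real.exp 1 * T / δ) ^ (2 * θ)))) ∧
        (SMD.IsSMDRun X f ψ (fun t => η / √(t : ℝ)) x₁ x g ξ →
          SMD.HoldsWithProb μ (1 - δ) (fun ω =>
            f (SMD.avgIterate x T ω) - f xstar ≤
              C * Real.log (Real.exp 1 * T) / √(T : ℝ) * (SMD.bregman ψ xstar x₁ / η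
                + η * (G ^ 2 + φ ^ 2 * Real.log (Real.exp 1 / δ) ^ (2 * θ))))) := by
  set K : ℝ := (4 * θ) ^ (2 * θ)
  set M : ℝ := (2 * θ) ^ (2 * θ) * Real.exp 1
  have hK : 0 < K := Real.rpow_pos_of_pos (by linarith) _
  have hM : 0 < M := mul_pos (Real.rpow_pos_of_pos (by linarith) _) (Real.exp_pos 1)
  have h3 : (0 : ℝ) < 3 ^ (2 * θ) := Real.rpow_pos_of_pos (by norm_num) _
  set C : ℝ := 2 + 20 * K + 128 * 3 ^ (2 * θ) + 128 * (3 ^ (2 * θ) * M) with hC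
  refine ⟨C, by positivity, ?_⟩
  intro E _ _ _ Ω _ μ _ X f xstar ψ x₁ x g ξ G φ η δ T _ hf hxs hmin hψ hG0 hG hξ hφ hw hη hδ hδ1 hT
  have hT0 : (0 : ℝ) < T := by exact_mod_cast hT
  have hT1 : (1 : ℝ) ≤ T := by exact_mod_cast hT
  have hl := SMD.one_le_log_exp_div hδ hδ1
  set l := Real.log (Real.exp 1 / δ)
  have hCs : 0 ≤ 128 * (3 ^ (2 * θ) * M) := by positivity
  constructor
  · intro hrun
    have hB : 0 ≤ SMD.bregman ψ xstar x₁ := le_trans (by positivity)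
      (hψ.half_sq_norm_le_bregman (hψ.subset_domain hxs) hrun.init_mem_interior)
    set B := SMD.bregman ψ xstar x₁
    set Λ := Real.log (Real.exp 1 * T / δ)
    have hΛ : 0 ≤ Λ := by
      refine Real.log_nonneg ?_
      rw [le_div_iff₀ hδ]
      nlinarith [Real.add_one_le_exp 1]
    obtain ⟨A, hA, hμA, hA'⟩ := hrun.holdsWithProb_sum_regret_le hθ hφ hξ hw hδ hδ1 hψ hf.1
      (fun _ _ => hη) hxs hmin hG0 hG hT (S := η ^ 2 * T) (H := η ^ 2 * (3 ^ (2 * θ) * Λ ^ (2 * θ)))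
      (by simp [mul_comm])
      (fun t ht => by
        have ht1 := (Finset.mem_Icc.1 ht).1
        have ht0 : (0 : ℝ) < t := by exact_mod_cast ht1
        have htT : (t : ℝ) ≤ T := by exact_mod_cast (Finset.mem_Icc.1 ht).2
        have h1 : SMD.truncLevel δ t ≤ 3 * Λ := by
          refine (SMD.truncLevel_le hδ hδ1 ht1).trans ?_
          gcongr
          exact Real.log_le_log (by positivity) (by gcongr)
        rw [← Real.mul_rpow (by norm_num) hΛ]
        have h0 : 0 ≤ SMD.truncLevel δ t := by linarith [SMD.log_exp_div_le_truncLevel hδ ht1]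
        exact mul_le_mul_of_nonneg_left (Real.rpow_le_rpow h0 h1 (by linarith)) (sq_nonneg η))
    refine ⟨A, hA, hμA, fun ω hω => ?_⟩
    have h1 : ∑ t ∈ Finset.Icc 1 T, η * (f (x t ω) - f xstar) ≤
        2 * (B + G ^ 2 * (η ^ 2 * T) + 10 * K * φ ^ 2 * (η ^ 2 * T) * l) +
          128 * φ ^ 2 * (η ^ 2 * (3 ^ (2 * θ) * Λ ^ (2 * θ))) := hA' ω hω
    beta_reduce
    rw [← Finset.mul_sum] at h1
    have h2 := mul_le_mul_of_nonneg_left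
      (hrun.mul_gap_avgIterate_le hf hT (f xstar) ω) hη.le
    have e : C / T * (B / η + η * (G ^ 2 + φ ^ 2 * l) * T + η * φ ^ 2 * Λ ^ (2 * θ)) =
        (C * B + C * (η ^ 2 * G ^ 2 * T) + C * (η ^ 2 * φ ^ 2 * l * T) +
          C * (η ^ 2 * φ ^ 2 * Λ ^ (2 * θ))) / (η * T) := by
      field_simp
      ring
    rw [e, le_div_iff₀ (by positivity)]
    have c1 : 2 * B ≤ C * B := mul_le_mul_of_nonneg_right (by linarith) hB
    have c2 : 2 * (η ^ 2 * G ^ 2 * T) ≤ C * (η ^ 2 * G ^ 2 * T) :=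
      mul_le_mul_of_nonneg_right (by linarith) (by positivity)
    have c3 : 20 * K * (η ^ 2 * φ ^ 2 * l * T) ≤ C * (η ^ 2 * φ ^ 2 * l * T) :=
      mul_le_mul_of_nonneg_right (by linarith) (by positivity)
    have c4 : 128 * 3 ^ (2 * θ) * (η ^ 2 * φ ^ 2 * Λ ^ (2 * θ)) ≤
        C * (η ^ 2 * φ ^ 2 * Λ ^ (2 * θ)) :=
      mul_le_mul_of_nonneg_right (by linarith) (by positivity)
    linarith
  · intro hrun
    have hB : 0 ≤ SMD.bregman ψ xstar x₁ := le_trans (by positivity)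
      (hψ.half_sq_norm_le_bregman (hψ.subset_domain hxs) hrun.init_mem_interior)
    set B := SMD.bregman ψ xstar x₁
    set L := Real.log (Real.exp 1 * T) with hLdef
    have hL : 1 ≤ L := by
      rw [hLdef, Real.log_mul (Real.exp_pos 1).ne' hT0.ne', Real.log_exp]
      linarith [Real.log_nonneg hT1]
    have hstep : ∀ t : ℕ, t ≥ 1 → 0 < η / √(t : ℝ) := fun t ht => by
      have : (0 : ℝ) < t := by exact_mod_cast ht
      positivity
    obtain ⟨A, hA, hμA, hA'⟩ := hrun.holdsWithProb_sum_regret_le hθ hφ hξ hw hδ hδ1 hψ hf.1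
      hstep hxs hmin hG0 hG hT (S := η ^ 2 * L) (H := η ^ 2 * (3 ^ (2 * θ) * l ^ (2 * θ) * M))
      (SMD.sum_sq_div_sqrt_le hT)
      (fun t ht => by
        have ht1 := (Finset.mem_Icc.1 ht).1
        have ht0 : (0 : ℝ) < t := by exact_mod_cast ht1
        rw [div_pow, Real.sq_sqrt ht0.le, div_mul_eq_mul_div, div_le_iff₀ ht0, mul_assoc]
        exact mul_le_mul_of_nonneg_left (SMD.truncLevel_rpow_le hθ hδ hδ1 ht1) (sq_nonneg η))
    refine ⟨A, hA, hμA, fun ω hω => ?_⟩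
    have h1 : ∑ t ∈ Finset.Icc 1 T, η / √(t : ℝ) * (f (x t ω) - f xstar) ≤
        2 * (B + G ^ 2 * (η ^ 2 * L) + 10 * K * φ ^ 2 * (η ^ 2 * L) * l) +
          128 * φ ^ 2 * (η ^ 2 * (3 ^ (2 * θ) * l ^ (2 * θ) * M)) := hA' ω hω
    beta_reduce
    -- The step sizes decrease and the gaps are nonnegative, so the smallest step bounds the sum.
    have h2 : η / √(T : ℝ) * ∑ t ∈ Finset.Icc 1 T, (f (x t ω) - f xstar) ≤
        ∑ t ∈ Finset.Icc 1 T, η / √(t : ℝ) * (f (x t ω) - f xstar) := by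
      rw [Finset.mul_sum]
      refine Finset.sum_le_sum fun t ht => ?_
      have ht1 := (Finset.mem_Icc.1 ht).1
      have ht0 : (0 : ℝ) < t := by exact_mod_cast ht1
      have htT : (t : ℝ) ≤ T := by exact_mod_cast (Finset.mem_Icc.1 ht).2
      exact mul_le_mul_of_nonneg_right
        (div_le_div_of_nonneg_left hη.le (Real.sqrt_pos.2 ht0) (Real.sqrt_le_sqrt htT))
        (sub_nonneg.2 (hmin (hrun.mem ht1 ω)))
    have h3' := mul_le_mul_of_nonneg_left
      (hrun.mul_gap_avgIterate_le hf hT (f xstar) ω) (hstep T hT).le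
    have hsT : 0 < √(T : ℝ) := Real.sqrt_pos.2 hT0
    have e1 : η / √(T : ℝ) * (T * (f (SMD.avgIterate x T ω) - f xstar)) =
        (f (SMD.avgIterate x T ω) - f xstar) * (η * √(T : ℝ)) := by
      have : (T : ℝ) = √(T : ℝ) * √(T : ℝ) := (Real.mul_self_sqrt hT0.le).symm
      rw [div_mul_eq_mul_div, div_eq_iff hsT.ne']
      linear_combination η * (f (SMD.avgIterate x T ω) - f xstar) * this
    rw [e1] at h3'
    have e : C * L / √(T : ℝ) * (B / η + η * (G ^ 2 + φ ^ 2 * l ^ (2 * θ))) =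
        (C * (L * B) + C * (η ^ 2 * G ^ 2 * L) + C * (η ^ 2 * φ ^ 2 * l ^ (2 * θ) * L)) /
          (η * √(T : ℝ)) := by
      field_simp
      ring
    rw [e, le_div_iff₀ (by positivity)]
    have hlθ : l ≤ l ^ (2 * θ) := Real.self_le_rpow_of_one_le hl (by linarith)
    have c1 : 2 * B ≤ C * (L * B) := by
      have h4 : B ≤ L * B := le_mul_of_one_le_left hB hL
      exact mul_le_mul (by linarith) h4 hB (by positivity)
    have c2 : 2 * (η ^ 2 * G ^ 2 * L) ≤ C * (η ^ 2 * G ^ 2 * L) :=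
      mul_le_mul_of_nonneg_right (by linarith) (by positivity)
    have c3 : 20 * K * (η ^ 2 * φ ^ 2 * l * L) ≤ 20 * K * (η ^ 2 * φ ^ 2 * l ^ (2 * θ) * L) := by
      gcongr
    have c4 : 128 * (3 ^ (2 * θ) * M) * (η ^ 2 * φ ^ 2 * l ^ (2 * θ) * 1) ≤
        128 * (3 ^ (2 * θ) * M) * (η ^ 2 * φ ^ 2 * l ^ (2 * θ) * L) := by
      gcongr
    have c5 : (20 * K + 128 * (3 ^ (2 * θ) * M)) * (η ^ 2 * φ ^ 2 * l ^ (2 * θ) * L) ≤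
        C * (η ^ 2 * φ ^ 2 * l ^ (2 * θ) * L) :=
      mul_le_mul_of_nonneg_right (by linarith) (by positivity)
    linarith
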